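/- A flat knot is an equivalence class of flat Gauss diagrams (oriented circles with finitely many arrows joining distinct points of the circle, one arrow for each flat crossing, whose tail lies on the branch that crosses the other branch from left to right) under the flat Reidemeister moves. The index $n(e)$ of an arrow $e$ is the number of arrow tails minus the number of arrow heads in the open interval of the circle that runs from the tail to the head of $e$. A diagram is checkerboard colorable if $n(e)\equiv 0 \pmod 2$ for all its arrows $e$, and a flat knot is checkerboard colorable if at least one of its diagrams is. For a diagram $D$ with $cr(D)$ flat crossings, a state $S$ is obtained by choosing at each flat crossing either the oriented smoothing or the disoriented smoothing; the latter joins the two incoming edges at a cusp and the two outgoing edges at a cusp. Let $|S|$ be the number of loops of $S$. On a loop, two consecutive cusps whose acute angles lie on the same side of the loop cancel; after all cancellations, let $|m|$ be the number of remaining cusps (it is even). Put $\langle S\rangle=\prod_{C} K_{|m_C|/2}$, the product over the loops $C$ of $S$, where $K_0=1$ and $K_1,K_2,\dots$ are variables. The flat arrow polynomial of $D$ and its normalization are $$A(D)=\sum_S(-2)^{|S|-1}\langle S\rangle,\qquad \bar A(D)=(-1)^{cr(D)}A(D)\in\mathbb Z[K_1,K_2,\dots].$$ Theorem. Let $\alpha$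 be a checkerboard colorable flat knot. Then for every diagram $D$ of $\alpha$ (checkerboard colorable or not), the constant term $C(D)$ of $A(D)$ satisfies $C(D)\equiv 1 \pmod 2$; equivalently, the constant term $\bar C(\alpha)=(-1)^{cr(D)}C(D)$ of $\bar A(D)$ is odd. -/

import Mathlib

/-- An endpoint of an arrow of a Gauss diagram: the pair `(a, true)` is the tail (written `O`)
of the arrow with label `a`, and `(a, false)` is its head (written `U`). -/
abbrev ArrowEnd : Type := ℕ × Bool

/-- A flat Gauss diagram of a knot, given by a flat Gauss code: the endpoints of the arrows in the
order in which they are met when one travels once around the oriented skeleton circle, starting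
from a base point that is not an endpoint. Each endpoint is met exactly once, and an arrow whose
tail (head) occurs has a head (tail) as well. The empty word is the circle without arrows.

Convention: at a flat crossing, the tail lies on the branch that crosses the other branch from
left to right, i.e. (direction of the tail branch, direction of the head branch) is a positive
frame. -/
structure FlatGaussDiagram where
  word : List ArrowEnd
  nodup : word.Nodup
  closed : ∀ a b, (a, b) ∈ word → (a, !b) ∈ word

/-- The flat Reidemeister moves on Gauss codes, together with the change of base point and the
relabelling of arrows. (The purely virtual and mixed moves do not change the Gauss diagram.) -/
inductive FlatMove : List ArrowEnd → List ArrowEnd → Prop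
  /-- Changing the base point on the skeleton. -/
  | rotate (u v : List ArrowEnd) : FlatMove (u ++ v) (v ++ u)
  /-- Renaming the arrows. -/
  | relabel (σ : Equiv.Perm ℕ) (w : List ArrowEnd) :
      FlatMove w (w.map fun p => (σ p.1, p.2))
  /-- First flat Reidemeister move: an arrow, of either direction, with adjacent endpoints. -/
  | fr1 (a : ℕ) (s : Bool) (w : List ArrowEnd) :
      FlatMove w ((a, s) :: (a, !s) :: w)
  /-- Second flat Reidemeister move between two branches that run in parallel. -/
  | fr2_parallel (a b : ℕ) (s : Bool) (u v : List ArrowEnd) :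
      FlatMove (u ++ v) ([(a, s), (b, !s)] ++ u ++ [(a, !s), (b, s)] ++ v)
  /-- Second flat Reidemeister move between two branches that run in opposite directions. -/
  | fr2_antiparallel (a b : ℕ) (s : Bool) (u v : List ArrowEnd) :
      FlatMove (u ++ v) ([(a, s), (b, !s)] ++ u ++ [(b, s), (a, !s)] ++ v)
  /-- Third flat Reidemeister move for three branches `1, 2, 3` whose directions lie in an open
  half plane, in counterclockwise order; `a`, `b`, `c` are the crossings `12`, `13`, `23`.
  The skeleton meets the branches in the cyclic order `1, 2, 3`. -/
  | fr3_acyclic (a b c : ℕ) (u v w : List ArrowEnd) :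
      FlatMove
        ([(a, true), (b, true)] ++ u ++ [(a, false), (c, true)] ++ v ++
          [(b, false), (c, false)] ++ w)
        ([(b, true), (a, true)] ++ u ++ [(c, true), (a, false)] ++ v ++
          [(c, false), (b, false)] ++ w)
  /-- The same configuration, with the branches met in the cyclic order `1, 3, 2`. -/
  | fr3_acyclic' (a b c : ℕ) (u v w : List ArrowEnd) :
      FlatMove
        ([(a, true), (b, true)] ++ u ++ [(b, false), (c, false)] ++ v ++
          [(a, false), (c, true)] ++ w)
        ([(b, true), (a, true)] ++ u ++ [(c, false), (b, false)] ++ v ++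
          [(c, true), (a, false)] ++ w)
  /-- Third flat Reidemeister move for three branches `1, 2, 3` whose directions do not lie in a
  half plane, in counterclockwise order (so that the triangle is coherently oriented);
  `a`, `b`, `c` are the crossings `12`, `23`, `31`.
  The skeleton meets the branches in the cyclic order `1, 2, 3`. -/
  | fr3_cyclic (a b c : ℕ) (u v w : List ArrowEnd) :
      FlatMove
        ([(c, false), (a, true)] ++ u ++ [(a, false), (b, true)] ++ v ++
          [(b, false), (c, true)] ++ w)
        ([(a, true), (c, false)] ++ u ++ [(b, true), (a, false)] ++ v ++
          [(c, true), (b, false)] ++ w)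
  /-- The same configuration, with the branches met in the cyclic order `1, 3, 2`. -/
  | fr3_cyclic' (a b c : ℕ) (u v w : List ArrowEnd) :
      FlatMove
        ([(c, false), (a, true)] ++ u ++ [(b, false), (c, true)] ++ v ++
          [(a, false), (b, true)] ++ w)
        ([(a, true), (c, false)] ++ u ++ [(c, true), (b, false)] ++ v ++
          [(b, true), (a, false)] ++ w)

/-- A flat knot: a flat Gauss diagram up to the equivalence relation generated by the moves. -/
def FlatKnot : Type := Quot fun D D' : FlatGaussDiagram => FlatMove D.word D'.word

/-- The flat knot represented by a diagram. -/
def FlatGaussDiagram.toFlatKnot (D : FlatGaussDiagram) : FlatKnot := Quot.mk _ D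

namespace FlatGaussDiagram

/-- The arrows (flat crossings) of the diagram. -/
def arrows (D : FlatGaussDiagram) : Finset ℕ := (D.word.map Prod.fst).toFinset

/-- The crossing number of the diagram. -/
def cr (D : FlatGaussDiagram) : ℕ := D.arrows.card

/-- The endpoints in the open interval of the skeleton from the tail to the head of `a`. -/
def interval (D : FlatGaussDiagram) (a : ℕ) : List ArrowEnd :=
  (D.word.rotate (D.word.idxOf (a, true))).tail.takeWhile (· ≠ (a, false))

/-- The index of the arrow `a`: the number of arrow tails minus the number of arrow heads in the
open interval from the tail to the head of `a`. -/
def index (D : FlatGaussDiagram) (a : ℕ) : ℤ :=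
  ((D.interval a).countP (fun p => p.2) : ℤ) - ((D.interval a).countP (fun p => !p.2) : ℤ)

/-- The diagram is mod `p` Alexander numberable if all its arrow indices vanish mod `p`. -/
def IsAlexanderNumberable (p : ℕ) (D : FlatGaussDiagram) : Prop :=
  ∀ a ∈ D.arrows, D.index a ≡ 0 [ZMOD p]

/-- The diagram is checkerboard colorable if it is mod `2` Alexander numberable. -/
def IsCheckerboardColorable (D : FlatGaussDiagram) : Prop := D.IsAlexanderNumberable 2

/-- The arrow endpoints of the diagram, as a type. -/
abbrev Endpoint (D : FlatGaussDiagram) : Type := {p : ArrowEnd // p ∈ D.word}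

/-- The other endpoint of the same arrow. -/
def partner (D : FlatGaussDiagram) (p : D.Endpoint) : D.Endpoint :=
  ⟨(p.1.1, !p.1.2), D.closed _ _ p.2⟩

/-- The marked points of the skeleton: the base point `none` and the arrow endpoints. Marking the
base point guarantees that the circle without arrows has an edge. -/
abbrev Pt (D : FlatGaussDiagram) : Type := Option D.Endpoint

/-- The cyclic successor on the marked points, in the direction of the skeleton. -/
def succ (D : FlatGaussDiagram) : Equiv.Perm D.Pt :=
  (none :: D.word.attach.map some).formPerm

/-- The half-edges: `(x, true)` is the outgoing half-edge at the point `x` and `(x, false)` is the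
incoming half-edge at `x`. The edge out of `x` runs from `x` to the successor of `x`. -/
abbrev HalfEdge (D : FlatGaussDiagram) : Type := D.Pt × Bool

/-- The involution that exchanges the two halves of each edge. -/
def edgeFlip (D : FlatGaussDiagram) : D.HalfEdge → D.HalfEdge
  | (x, true) => (D.succ x, false)
  | (x, false) => (D.succ.symm x, true)

/-- The state `T` is the set of arrows whose crossing receives the disoriented smoothing; all other
crossings receive the oriented smoothing. The smoothing glues half-edges in pairs: the oriented
smoothing glues the incoming half-edge of each branch to the outgoing one of the other branch, the
disoriented smoothing glues the two incoming half-edges and the two outgoing half-edges. Nothing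
happens at the base point. -/
def smooth (D : FlatGaussDiagram) (T : Finset ℕ) : D.HalfEdge → D.HalfEdge
  | (none, b) => (none, !b)
  | (some p, b) => (some (D.partner p), if p.1.1 ∈ T then b else !b)

theorem edgeFlip_involutive (D : FlatGaussDiagram) : Function.Involutive D.edgeFlip := by
  rintro ⟨x, _ | _⟩ <;> simp [edgeFlip]

theorem smooth_involutive (D : FlatGaussDiagram) (T : Finset ℕ) :
    Function.Involutive (D.smooth T) := by
  rintro ⟨_ | p, b⟩
  · simp [smooth]
  · by_cases h : p.1.1 ∈ T <;> simp [smooth, partner, h]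

/-- The loops of a state: two half-edges lie on the same loop if they are connected by a chain of
edges and of gluings at the smoothed crossings. -/
def Loop (D : FlatGaussDiagram) (T : Finset ℕ) : Type :=
  Quot fun h h' : D.HalfEdge => h' = D.edgeFlip h ∨ h' = D.smooth T h

/-- The step of a walk along a loop: arriving at a point by the half-edge `h`, pass to the half-edge
glued to `h` and follow its edge to the next point. The orbit of `h` is one traversal of the loop of
`h`, in the direction that arrives by `h`. -/
def step (D : FlatGaussDiagram) (T : Finset ℕ) : Equiv.Perm D.HalfEdge :=
  (D.smooth_involutive T).toPerm.trans D.edgeFlip_involutive.toPerm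

/-- The contribution to the cusp multiplicity of arriving by the half-edge `h`. There is a cusp only
at a disoriented smoothing. It counts `+1` if one passes there from the left to the right half-edge
of the pair that is glued (as seen with the directions of both branches pointing up), and `-1` if
one passes from right to left. The tail branch comes in on the left and goes out on the right.

This is the multiplicity: going around a loop the cusps are alternately sinks and sources of the
local orientation, so two consecutive cusps get opposite signs, and cancel, if their acute sides lie
on the same side of the loop, and they get equal signs, and add up, if not. -/
def cuspSign (D : FlatGaussDiagram) (T : Finset ℕ) : D.HalfEdge → ℤ
  | (none, _) => 0
  | (some p, b) => if p.1.1 ∈ T then (if p.1.2 = b then -1 else 1) else 0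

open Classical in
/-- The total signed number of cusps on one traversal of the loop, arriving by `h`. -/
noncomputable def cuspSum (D : FlatGaussDiagram) (T : Finset ℕ) (h : D.HalfEdge) : ℤ :=
  ∑ h' : D.HalfEdge, if (D.step T).SameCycle h h' then D.cuspSign T h' else 0

theorem cuspSign_smooth (D : FlatGaussDiagram) (T : Finset ℕ) (h : D.HalfEdge) :
    D.cuspSign T (D.smooth T h) = - D.cuspSign T h := by
  obtain ⟨_ | p, b⟩ := h
  · simp [cuspSign, smooth]
  · obtain ⟨⟨a, s⟩, hp⟩ := p
    by_cases h : a ∈ T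
    · cases s <;> cases b <;> simp [cuspSign, smooth, partner, h]
    · simp [cuspSign, smooth, partner, h]

theorem step_apply (D : FlatGaussDiagram) (T : Finset ℕ) (h : D.HalfEdge) :
    D.step T h = D.edgeFlip (D.smooth T h) := rfl

theorem step_smooth (D : FlatGaussDiagram) (T : Finset ℕ) (h : D.HalfEdge) :
    D.step T (D.smooth T h) = D.edgeFlip h := by
  rw [step_apply, D.smooth_involutive T]

theorem conj_step (D : FlatGaussDiagram) (T : Finset ℕ) :
    (D.smooth_involutive T).toPerm * D.step T * (D.smooth_involutive T).toPerm⁻¹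
      = (D.step T)⁻¹ := by
  rw [eq_inv_iff_mul_eq_one]
  ext1 h
  simp only [Equiv.Perm.mul_apply, Function.Involutive.toPerm_symm, Equiv.Perm.inv_def,
    Function.Involutive.coe_toPerm, step_apply, Equiv.Perm.one_apply]
  rw [D.smooth_involutive T, D.edgeFlip_involutive, D.smooth_involutive T]

theorem sameCycle_smooth (D : FlatGaussDiagram) (T : Finset ℕ) (h h' : D.HalfEdge) :
    (D.step T).SameCycle (D.smooth T h) (D.smooth T h') ↔ (D.step T).SameCycle h h' := by
  have := (Equiv.Perm.sameCycle_conj (f := D.step T) (g := (D.smooth_involutive T).toPerm)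
    (x := D.smooth T h) (y := D.smooth T h'))
  rw [conj_step, Equiv.Perm.sameCycle_inv] at this
  rw [this]
  simp only [Function.Involutive.toPerm_symm, Equiv.Perm.inv_def,
    Function.Involutive.coe_toPerm]
  rw [D.smooth_involutive T, D.smooth_involutive T]

/-- Traversing a loop in the other direction changes the sign of the cusp sum. -/
theorem cuspSum_smooth (D : FlatGaussDiagram) (T : Finset ℕ) (h : D.HalfEdge) :
    D.cuspSum T (D.smooth T h) = - D.cuspSum T h := by
  classical
  unfold cuspSum
  rw [← Finset.sum_neg_distrib, ← Equiv.sum_comp (D.smooth_involutive T).toPerm]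
  refine Finset.sum_congr rfl fun h' _ => ?_
  simp only [Function.Involutive.coe_toPerm, sameCycle_smooth, cuspSign_smooth]
  split_ifs <;> simp

theorem cuspSum_step (D : FlatGaussDiagram) (T : Finset ℕ) (h : D.HalfEdge) :
    D.cuspSum T (D.step T h) = D.cuspSum T h := by
  classical
  unfold cuspSum
  simp only [Equiv.Perm.sameCycle_apply_left]

theorem cuspSum_edgeFlip (D : FlatGaussDiagram) (T : Finset ℕ) (h : D.HalfEdge) :
    D.cuspSum T (D.edgeFlip h) = - D.cuspSum T h := by
  rw [← D.step_smooth T, cuspSum_step, cuspSum_smooth]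

/-- The absolute value of the cusp multiplicity of a loop. -/
noncomputable def cuspMultiplicity (D : FlatGaussDiagram) (T : Finset ℕ) (C : D.Loop T) : ℕ :=
  Quot.lift (fun h => (D.cuspSum T h).natAbs)
    (by
      rintro h h' (rfl | rfl)
      · simp [cuspSum_edgeFlip]
      · simp [cuspSum_smooth]) C

noncomputable instance (D : FlatGaussDiagram) (T : Finset ℕ) : Fintype (D.Loop T) :=
  @Fintype.ofFinite _ (Quot.finite _)

/-- The variables `K_n` of the arrow polynomial, with the convention `K_0 = 1`. -/
noncomputable def arrowVar (n : ℕ) : MvPolynomial ℕ+ ℤ :=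
  if h : 0 < n then MvPolynomial.X ⟨n, h⟩ else 1

/-- The evaluation of a state: the product of `K_{|m| / 2}` over its loops, where `m` is the cusp
multiplicity of the loop (an even number). -/
noncomputable def stateEval (D : FlatGaussDiagram) (T : Finset ℕ) : MvPolynomial ℕ+ ℤ :=
  ∏ C : D.Loop T, arrowVar (D.cuspMultiplicity T C / 2)

/-- The flat arrow polynomial `A(D) = ∑_S (-2)^{|S| - 1} ⟨S⟩`; every state has at least one loop. -/
noncomputable def arrowPolynomial (D : FlatGaussDiagram) : MvPolynomial ℕ+ ℤ :=
  ∑ T ∈ D.arrows.powerset, (-2) ^ (Fintype.card (D.Loop T) - 1) * D.stateEval T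

/-- The normalized flat arrow polynomial `(-1)^{cr(D)} A(D)`. -/
noncomputable def normalizedArrowPolynomial (D : FlatGaussDiagram) : MvPolynomial ℕ+ ℤ :=
  (-1) ^ D.cr * D.arrowPolynomial

end FlatGaussDiagram

/-- A flat knot is checkerboard colorable if it admits a checkerboard colorable diagram. -/
def FlatKnot.IsCheckerboardColorable (α : FlatKnot) : Prop :=
  ∃ D : FlatGaussDiagram, D.toFlatKnot = α ∧ D.IsCheckerboardColorable

/-! Modulo two the factor `(-2)^(|S|-1)` leaves only the states with one loop, so the constant term
counts the one-loop states whose cusps cancel. This count is computed by a vertex model. For even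
`N`, label the edges by `ZMod N` so that passing a smoothing changes the label by the cusp sign
(`IsPotential`), with label 0 at the base point. A state that admits a labelling has `N^(|S|-1)`
normalized ones, which is odd only for one loop (`natCast_card_isPotential`). If `N` exceeds the
number of half-edges, a one-loop state has a labelling exactly when its cusp sum is zero, and the
state sum is the constant term modulo two (`stateMatrix_eq_constantCoeff`).

The state sum is a contraction of local weights, one per crossing. As a free loop counts `N = 0`
modulo two, these weights satisfy all flat Reidemeister moves, including the Yang-Baxter equations.
So the state sum is an invariant of flat knots for each even `N` (`stateMatrix_eq_of_flatMove`), and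
it may be evaluated on a checkerboard colorable diagram.

There the alternating orientation of the edges orients the loops of every state. In a one-loop state
this orientation meets both half-edges of an endpoint in the same traversal, with opposite cusp
signs, so the cusps cancel (`cuspSum_eq_zero_of_checkerboard`). Hence every one-loop state has a
labelling for every `N`, and the state sum is the same for all even `N`. For `N = 2` the weight of a
crossing is that of two strands passing through each other, so all arrows can be deleted and the
value is 1 (`stateMatrix_two`). -/

/-! ### Local weights of a crossing. -/

/-- A smoothing of a crossing together with labels in `ZMod N` of the two strands that result: the
strands of the disoriented smoothing (`true`) carry the labels `(i, i + 1)` and `(j, j + 1)`, those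
of the oriented smoothing the constant labels `i` and `j`. -/
abbrev LabelledSmoothing (N : ℕ) : Type := Bool × ZMod N × ZMod N

namespace LabelledSmoothing

variable {N : ℕ}

/-- The label of the incoming edge at the tail (`true`) or head (`false`). -/
def inLabel (c : LabelledSmoothing N) : Bool → ZMod N
  | true => c.2.1
  | false => if c.1 then c.2.1 + 1 else c.2.2

/-- The label of the outgoing edge at the tail (`true`) or head (`false`). -/
def outLabel (c : LabelledSmoothing N) : Bool → ZMod N
  | true => if c.1 then c.2.2 + 1 else c.2.2
  | false => if c.1 then c.2.2 else c.2.1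

/-- The matrix unit that passes from the incoming to the outgoing label. -/
def matrix (R : Type*) [CommSemiring R] (c : LabelledSmoothing N) (s : Bool) :
    Matrix (ZMod N) (ZMod N) R :=
  Matrix.single (c.inLabel s) (c.outLabel s) 1

/-- The number modulo two of smoothings compatible with given labels: `p`, `q` are the labels into
and out of the tail, `r`, `t` those into and out of the head. -/
def weight (p q r t : ZMod N) : ZMod 2 :=
  (if p = t then if q = r then 1 else 0 else 0) +
    (if r = p + 1 then if q = t + 1 then 1 else 0 else 0)

theorem ite_add_zero_distrib (P : Prop) [Decidable P] (a b : ZMod 2) :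
    (if P then a + b else 0) = (if P then a else 0) + (if P then b else 0) := by
  split_ifs <;> simp

theorem natCast_eq_zero_of_even (hN : Even N) : (N : ZMod 2) = 0 :=
  (ZMod.natCast_eq_zero_iff_even).2 hN

/-! ### Reidemeister identities for the weights. -/

section weight

variable [NeZero N]

/-- For each kind of smoothing the four edge labels determine the two strand labels, so each kind
contributes at most one term. -/
theorem sum_matrix_mul (p q r t : ZMod N) :
    ∑ c : LabelledSmoothing N, c.matrix (ZMod 2) true p q * c.matrix (ZMod 2) false r t =
      weight p q r t := by
  simp only [Fintype.sum_prod_type, Fintype.sum_bool, matrix, inLabel, outLabel,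
    Matrix.single_apply, weight, if_true]
  rw [add_comm]
  congr 1
  · simp only [Bool.false_eq_true, if_false, ite_and, mul_ite, mul_one, mul_zero
      ]
    rw [Finset.sum_eq_single p (by intro b _ hb; simp [hb]) (by simp),
      Finset.sum_eq_single q (by intro b _ hb; simp [hb]) (by simp)]
    simp only [if_true]
    split_ifs <;> rfl
  · simp only [ite_and, mul_ite, mul_one, mul_zero
      ]
    rw [Finset.sum_eq_single p (by intro b _ hb; simp [hb]) (by simp),
      Finset.sum_eq_single t (by intro b _ hb; simp [hb]) (by simp)]
    simp only [if_true]
    split_ifs <;> first | rfl | simp_all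

theorem sum_ite_eq_add_one (a : ZMod N) (f : ZMod N → ZMod 2) :
    ∑ x, (if a = x + 1 then f x else 0) = f (a - 1) := by
  simp [← sub_eq_iff_eq_add]

theorem sum_ite_eq_sub_one (a : ZMod N) (f : ZMod N → ZMod 2) :
    ∑ x, (if a = x - 1 then f x else 0) = f (a + 1) := by
  simp [eq_sub_iff_add_eq]

theorem sum_ite_eq_add_one_add_one (a : ZMod N) (f : ZMod N → ZMod 2) :
    ∑ x, (if a = x + 1 + 1 then f x else 0) = f (a - 1 - 1) := by
  simp [← sub_eq_iff_eq_add]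

theorem sum_ite_const (P : Prop) [Decidable P] (f : ZMod N → ZMod 2) :
    ∑ x, (if P then f x else 0) = if P then ∑ x, f x else 0 := by
  split_ifs <;> simp

/-- The oriented smoothing of a kink splits off a loop with `N` labels and vanishes modulo two; the
disoriented one gives the identity. -/
theorem sum_weight_tail_head (hN : Even N) (p q : ZMod N) :
    ∑ y, weight p y y q = if p = q then 1 else 0 := by
  simp [weight, Finset.sum_add_distrib, natCast_eq_zero_of_even hN]

theorem sum_weight_head_tail (hN : Even N) (p q : ZMod N) :
    ∑ y, weight y q p y = if p = q then 1 else 0 := by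
  simp [weight, Finset.sum_add_distrib, natCast_eq_zero_of_even hN, sum_ite_eq_add_one,
    eq_comm]

/-- Two oriented smoothings give the identity, the two mixed choices agree and cancel modulo two,
and two disoriented smoothings enclose a loop with `N` labels. -/
theorem sum_weight_bigon (hN : Even N) (p q r t : ZMod N) :
    ∑ y, ∑ z, weight p y r z * weight z t y q =
      if p = q then if r = t then 1 else 0 else 0 := by
  simp only [weight, Finset.sum_add_distrib, mul_add, sum_ite_eq_add_one,
    sum_ite_eq_sub_one, sum_ite_const, ite_add_zero_distrib, Finset.sum_ite_eq,
    Finset.sum_ite_eq', mul_ite, mul_zero, mul_one,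
    Finset.mem_univ, if_true]
  simp [natCast_eq_zero_of_even hN]
  grind

/-- Now the roles are exchanged: two oriented smoothings enclose the loop and two disoriented ones
give the identity. The mixed choices still cancel. -/
theorem sum_weight_bigon_antiparallel (hN : Even N) (p q r t : ZMod N) :
    ∑ y, ∑ z, weight p y z t * weight r z y q =
      if p = q then if r = t then 1 else 0 else 0 := by
  simp only [weight, Finset.sum_add_distrib, mul_add,
    sum_ite_const, ite_add_zero_distrib,
    Finset.sum_ite_eq', mul_ite, mul_zero, mul_one,
    Finset.mem_univ, if_true]
  simp [natCast_eq_zero_of_even hN]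
  grind

theorem sum_weight_bigon_antiparallel' (hN : Even N) (p q r t : ZMod N) :
    ∑ y, ∑ z, weight z t p y * weight y q r z =
      if p = q then if r = t then 1 else 0 else 0 := by
  simp only [weight, Finset.sum_add_distrib, mul_add, sum_ite_eq_add_one,
    sum_ite_const, ite_add_zero_distrib, Finset.sum_ite_eq,
    mul_ite, mul_zero, mul_one,
    Finset.mem_univ, if_true]
  simp [natCast_eq_zero_of_even hN, sub_eq_iff_eq_add]
  grind

/-- On each side exactly one of the eight choices closes the triangle to a loop, contributing a
multiple of `N`. In the others the outer labels determine the inner ones, and what remains is an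
identity of Kronecker deltas. -/
theorem sum_weight_acyclic_triangle (hN : Even N) (p₀ p₁ q₀ q₁ r₀ r₁ : ZMod N) :
    ∑ x, ∑ y, ∑ z, weight p₀ x q₀ y * weight x p₁ r₀ z * weight y q₁ z r₁ =
      ∑ x, ∑ y, ∑ z, weight p₀ x z r₁ * weight x p₁ y q₁ * weight q₀ y r₀ z := by
  simp only [weight, Finset.sum_add_distrib, mul_add,
    sum_ite_eq_add_one, sum_ite_eq_sub_one, sum_ite_const,
    sum_ite_eq_add_one_add_one, ite_add_zero_distrib, Finset.sum_ite_eq, Finset.sum_ite_eq',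
    mul_ite, mul_zero, mul_one, Finset.mem_univ, if_true]
  simp [natCast_eq_zero_of_even hN, sub_eq_iff_eq_add, eq_sub_iff_add_eq]
  grind

/-- The closed loop now comes from three oriented smoothings, on both sides. -/
theorem sum_weight_cyclic_triangle (hN : Even N) (p₀ p₁ q₀ q₁ r₀ r₁ : ZMod N) :
    ∑ x, ∑ y, ∑ z, weight x p₁ q₀ y * weight y q₁ r₀ z * weight z r₁ p₀ x =
      ∑ x, ∑ y, ∑ z, weight p₀ x y q₁ * weight q₀ y z r₁ * weight r₀ z x p₁ := by
  simp only [weight, Finset.sum_add_distrib, mul_add,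
    sum_ite_eq_add_one, sum_ite_const,
    ite_add_zero_distrib, Finset.sum_ite_eq',
    mul_ite, mul_zero, mul_one, Finset.mem_univ, if_true]
  simp [natCast_eq_zero_of_even hN, eq_sub_iff_add_eq]
  grind

end weight

/-- Both smoothings are compatible with the same labels only if `p ≠ q`, and then they cancel. What
survives is the weight of two strands that keep their labels. -/
theorem weight_two (p q r t : ZMod 2) :
    weight p q r t = (if p = q then 1 else 0) * (if r = t then 1 else 0) := by
  revert p q r t
  decide

end LabelledSmoothing

/-! ### From identities of tensors to identities of matrix products. -/

section Contraction

variable {ι κ n R : Type*} [Fintype ι] [Fintype κ] [Fintype n] [CommSemiring R]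

/-- Equal sums of tensor products act equally on the slot between the two factors. -/
theorem sum_mul_mul_congr {A B : ι → Matrix n n R} {A' B' : κ → Matrix n n R}
    (h : ∀ p q r t, ∑ i, A i p q * B i r t = ∑ j, A' j p q * B' j r t) (U : Matrix n n R) :
    ∑ i, A i * U * B i = ∑ j, A' j * U * B' j := by
  ext p t
  simp only [Matrix.sum_apply, Matrix.mul_apply, Finset.sum_mul]
  rw [Finset.sum_comm]
  rw [Finset.sum_comm (s := (Finset.univ : Finset κ))]
  refine Finset.sum_congr rfl fun r _ => ?_
  rw [Finset.sum_comm]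
  rw [Finset.sum_comm (s := (Finset.univ : Finset κ))]
  refine Finset.sum_congr rfl fun q _ => ?_
  have := congrArg (U q r * ·) (h p q r t)
  simp only [Finset.mul_sum] at this
  convert this using 2 <;> ring

/-- Equal sums of threefold tensor products act equally on the two slots between the factors. -/
theorem sum_mul_mul_mul_mul_congr {A B C : ι → Matrix n n R} {A' B' C' : κ → Matrix n n R}
    (h : ∀ p₀ p₁ q₀ q₁ r₀ r₁, ∑ i, A i p₀ p₁ * B i q₀ q₁ * C i r₀ r₁ =
      ∑ j, A' j p₀ p₁ * B' j q₀ q₁ * C' j r₀ r₁) (U V : Matrix n n R) :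
    ∑ i, A i * U * B i * V * C i = ∑ j, A' j * U * B' j * V * C' j := by
  ext p t
  simp only [Matrix.sum_apply, Matrix.mul_apply, Finset.sum_mul]
  iterate 4
    rw [Finset.sum_comm]
    rw [Finset.sum_comm (s := (Finset.univ : Finset κ))]
    refine Finset.sum_congr rfl fun _ _ => ?_
  rename_i r₀ _ q₁ _ q₀ _ p₁ _
  have := congrArg (U p₁ q₀ * V q₁ r₀ * ·) (h p p₁ q₀ q₁ r₀ t)
  simp only [Finset.mul_sum] at this
  convert this using 2 <;> ring

/-- Matrix products group the factors by branch; moving the inner edge labels outside groups them by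
crossing, where the sum over smoothings becomes a weight. -/
theorem sum_bigon_entries (f₁ f₂ : ι → n → R) (g₁ g₂ : κ → n → R) :
    ∑ x : ι × κ, (∑ y, f₁ x.1 y * g₁ x.2 y) * (∑ z, f₂ x.1 z * g₂ x.2 z) =
      ∑ y, ∑ z, (∑ i, f₁ i y * f₂ i z) * (∑ j, g₁ j y * g₂ j z) := by
  simp only [Finset.sum_mul_sum]
  rw [Finset.sum_comm]
  refine Finset.sum_congr rfl fun y _ => ?_
  rw [Finset.sum_comm]
  refine Finset.sum_congr rfl fun z _ => ?_
  rw [Fintype.sum_prod_type]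
  exact Finset.sum_congr rfl fun i _ => Finset.sum_congr rfl fun j _ => by ring

theorem sum_mul_sum_mul_sum {l m : Type*} [Fintype l] [Fintype m] (u : l → R) (v : m → R)
    (w : n → R) :
    (∑ a, u a) * (∑ b, v b) * (∑ c, w c) = ∑ a, ∑ b, ∑ c, u a * v b * w c := by
  rw [Finset.sum_mul_sum]
  simp only [Finset.sum_mul]
  simp only [Finset.mul_sum]

theorem sum_triangle_entries {μ : Type*} [Fintype μ] (f₁ f₂ : ι → n → R) (g₁ g₂ : κ → n → R)
    (h₁ h₂ : μ → n → R) :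
    ∑ x : ι × κ × μ, (∑ a, f₁ x.1 a * g₁ x.2.1 a) * (∑ b, f₂ x.1 b * h₁ x.2.2 b) *
        (∑ c, g₂ x.2.1 c * h₂ x.2.2 c) =
      ∑ a, ∑ b, ∑ c, (∑ i, f₁ i a * f₂ i b) * (∑ j, g₁ j a * g₂ j c) *
        (∑ k, h₁ k b * h₂ k c) := by
  simp only [sum_mul_sum_mul_sum]
  iterate 3
    rw [Finset.sum_comm]
    refine Finset.sum_congr rfl fun _ _ => ?_
  simp only [Fintype.sum_prod_type]
  exact Finset.sum_congr rfl fun i _ => Finset.sum_congr rfl fun j _ =>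
    Finset.sum_congr rfl fun k _ => by ring

end Contraction

/-! ### Reidemeister identities for the matrices. -/

namespace LabelledSmoothing

variable {N : ℕ} [NeZero N]

local notation "X" => matrix (ZMod 2)

theorem sum_matrix_mul' (p q r t : ZMod N) :
    ∑ c : LabelledSmoothing N, X c false p q * X c true r t = weight r t p q := by
  simp only [← sum_matrix_mul, mul_comm]

/-- Invariance under the first flat Reidemeister move. -/
theorem sum_matrix_mul_matrix (hN : Even N) (s : Bool) :
    ∑ c : LabelledSmoothing N, X c s * X c (!s) = 1 := by
  ext p q
  simp only [Matrix.sum_apply, Matrix.mul_apply, Matrix.one_apply]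
  rw [Finset.sum_comm]
  cases s
  · simp only [Bool.not_false, sum_matrix_mul', sum_weight_head_tail hN]
  · simp only [Bool.not_true, sum_matrix_mul, sum_weight_tail_head hN]

/-- Invariance under the second flat Reidemeister move for parallel branches. -/
theorem sum_matrix_parallel (hN : Even N) (s : Bool) (U : Matrix (ZMod N) (ZMod N) (ZMod 2)) :
    ∑ x : LabelledSmoothing N × LabelledSmoothing N,
      X x.1 s * X x.2 (!s) * U * (X x.1 (!s) * X x.2 s) = U := by
  refine (sum_mul_mul_congr (κ := Unit) (A' := fun _ => 1) (B' := fun _ => 1)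
    (fun p q r t => ?_) U).trans (by simp)
  simp only [Matrix.mul_apply]
  rw [sum_bigon_entries (fun i y => X i s p y) (fun i z => X i (!s) r z)
    (fun j y => X j (!s) y q) (fun j z => X j s z t)]
  cases s
  · simp only [Bool.not_false, sum_matrix_mul', sum_matrix_mul]
    rw [Finset.sum_comm, sum_weight_bigon hN]
    simp [Matrix.one_apply, ← ite_and, and_comm]
  · simp only [Bool.not_true, sum_matrix_mul', sum_matrix_mul]
    rw [sum_weight_bigon hN]
    simp [Matrix.one_apply, ← ite_and, and_comm]

/-- Invariance under the second flat Reidemeister move for antiparallel branches. -/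
theorem sum_matrix_antiparallel (hN : Even N) (s : Bool)
    (U : Matrix (ZMod N) (ZMod N) (ZMod 2)) :
    ∑ x : LabelledSmoothing N × LabelledSmoothing N,
      X x.1 s * X x.2 (!s) * U * (X x.2 s * X x.1 (!s)) = U := by
  refine (sum_mul_mul_congr (κ := Unit) (A' := fun _ => 1) (B' := fun _ => 1)
    (fun p q r t => ?_) U).trans (by simp)
  simp only [Matrix.mul_apply, mul_comm (X _ s r _)]
  rw [sum_bigon_entries (fun i y => X i s p y) (fun i z => X i (!s) z t)
    (fun j y => X j (!s) y q) (fun j z => X j s r z)]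
  cases s
  · simp only [Bool.not_false, sum_matrix_mul', sum_matrix_mul]
    rw [sum_weight_bigon_antiparallel' hN]
    simp [Matrix.one_apply, ← ite_and, and_comm]
  · simp only [Bool.not_true, sum_matrix_mul', sum_matrix_mul]
    rw [sum_weight_bigon_antiparallel hN]
    simp [Matrix.one_apply, ← ite_and, and_comm]

/-- The Yang-Baxter equation for an acyclic triangle. -/
theorem acyclic_triangle_entries (hN : Even N) (p₀ p₁ q₀ q₁ r₀ r₁ : ZMod N) :
    ∑ x : LabelledSmoothing N × LabelledSmoothing N × LabelledSmoothing N,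
      (X x.1 true * X x.2.1 true) p₀ p₁ * (X x.1 false * X x.2.2 true) q₀ q₁ *
        (X x.2.1 false * X x.2.2 false) r₀ r₁ =
    ∑ x : LabelledSmoothing N × LabelledSmoothing N × LabelledSmoothing N,
      (X x.2.1 true * X x.1 true) p₀ p₁ * (X x.2.2 true * X x.1 false) q₀ q₁ *
        (X x.2.2 false * X x.2.1 false) r₀ r₁ := by
  simp only [Matrix.mul_apply]
  rw [sum_triangle_entries (fun i y => X i true p₀ y) (fun i z => X i false q₀ z)
    (fun j y => X j true y p₁) (fun j z => X j false r₀ z)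
    (fun j y => X j true y q₁) (fun j z => X j false z r₁)]
  conv_rhs =>
    simp only [mul_comm (X _ true p₀ _), mul_comm (X _ true q₀ _), mul_comm (X _ false r₀ _)]
  rw [sum_triangle_entries (fun i y => X i true y p₁) (fun i z => X i false z q₁)
    (fun j y => X j true p₀ y) (fun j z => X j false z r₁)
    (fun j y => X j true q₀ y) (fun j z => X j false r₀ z)]
  simp only [sum_matrix_mul]
  rw [sum_weight_acyclic_triangle hN]
  exact Finset.sum_congr rfl fun i _ => Finset.sum_congr rfl fun j _ =>
    Finset.sum_congr rfl fun k _ => by ring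

/-- The Yang-Baxter equation for a cyclic triangle. -/
theorem cyclic_triangle_entries (hN : Even N) (p₀ p₁ q₀ q₁ r₀ r₁ : ZMod N) :
    ∑ x : LabelledSmoothing N × LabelledSmoothing N × LabelledSmoothing N,
      (X x.2.1 false * X x.1 true) p₀ p₁ * (X x.1 false * X x.2.2 true) q₀ q₁ *
        (X x.2.2 false * X x.2.1 true) r₀ r₁ =
    ∑ x : LabelledSmoothing N × LabelledSmoothing N × LabelledSmoothing N,
      (X x.1 true * X x.2.1 false) p₀ p₁ * (X x.2.2 true * X x.1 false) q₀ q₁ *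
        (X x.2.1 true * X x.2.2 false) r₀ r₁ := by
  simp only [Matrix.mul_apply]
  conv_lhs =>
    simp only [mul_comm (X _ false p₀ _), mul_comm (X _ false r₀ _)]
  rw [sum_triangle_entries (fun i y => X i true y p₁) (fun i z => X i false q₀ z)
    (fun j y => X j false p₀ y) (fun j z => X j true z r₁)
    (fun j y => X j true y q₁) (fun j z => X j false r₀ z)]
  conv_rhs => simp only [mul_comm (X _ true q₀ _)]
  rw [sum_triangle_entries (fun i y => X i true p₀ y) (fun i z => X i false z q₁)
    (fun j y => X j false y p₁) (fun j z => X j true r₀ z)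
    (fun j y => X j true q₀ y) (fun j z => X j false z r₁)]
  simp only [sum_matrix_mul, sum_matrix_mul']
  simpa only [mul_right_comm (weight _ _ _ _) (weight _ r₁ p₀ _),
    mul_right_comm (weight _ _ _ _) (weight r₀ _ _ p₁)] using
    sum_weight_cyclic_triangle hN p₀ p₁ q₀ q₁ r₀ r₁

/-- Any two strands cross freely when the labels are taken modulo two. -/
theorem sum_matrix_mul_mul_matrix_two (s : Bool) (U : Matrix (ZMod 2) (ZMod 2) (ZMod 2)) :
    ∑ c : LabelledSmoothing 2, X c s * U * X c (!s) = U := by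
  refine (sum_mul_mul_congr (κ := Unit) (A' := fun _ => 1) (B' := fun _ => 1)
    (fun p q r t => ?_) U).trans (by simp)
  cases s
  · simp only [Bool.not_false, sum_matrix_mul', weight_two]
    simp [Matrix.one_apply, ← ite_and, and_comm]
  · simp only [Bool.not_true, sum_matrix_mul, weight_two]
    simp [Matrix.one_apply, ← ite_and, and_comm]

end LabelledSmoothing

/-! ### Sums over assignments to finitely many arrows. -/

section Assignment

variable {I M : Type*} [Inhabited I]

/-- The extension of a function on a finite set by the default value. -/
def extendDefault (A : Finset ℕ) (c : A → I) : ℕ → I :=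
  fun n => if h : n ∈ A then c ⟨n, h⟩ else default

variable [Fintype I] [AddCommMonoid M]

/-- The sum over all assignments of values in `I` to the elements of `A`. -/
def assignmentSum (A : Finset ℕ) (F : (ℕ → I) → M) : M :=
  ∑ c : A → I, F (extendDefault A c)

theorem assignmentSum_congr {A : Finset ℕ} {F G : (ℕ → I) → M} (h : ∀ c, F c = G c) :
    assignmentSum A F = assignmentSum A G := by
  simp only [assignmentSum, h]

theorem assignmentSum_empty (F : (ℕ → I) → M) : assignmentSum ∅ F = F fun _ => default := by
  simp only [assignmentSum, Fintype.sum_unique]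
  congr 1

theorem assignmentSum_insert {a : ℕ} {A : Finset ℕ} (ha : a ∉ A) (F : (ℕ → I) → M) :
    assignmentSum (insert a A) F =
      assignmentSum A fun c => ∑ i, F (Function.update c a i) := by
  unfold assignmentSum
  rw [Finset.sum_comm, ← Fintype.sum_prod_type']
  refine Fintype.sum_equiv
    { toFun := fun c => (c ⟨a, Finset.mem_insert_self a A⟩,
        fun x => c ⟨x, Finset.mem_insert_of_mem x.2⟩)
      invFun := fun p x => if h : x.1 = a then p.1 else
        p.2 ⟨x, (Finset.mem_insert.1 x.2).resolve_left h⟩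
      left_inv := fun c => by
        ext1 ⟨x, hx⟩
        by_cases h : x = a
        · subst h; simp
        · simp [h]
      right_inv := fun p => by
        refine Prod.ext (by simp) ?_
        ext1 ⟨x, hx⟩
        have : x ≠ a := fun h => ha (h ▸ hx)
        simp [this] } _ _ fun c => ?_
  congr 1
  ext1 n
  by_cases hn : n = a
  · subst hn
    simp [extendDefault]
  · by_cases hA : n ∈ A <;> simp [extendDefault, hn, hA]

theorem assignmentSum_insert₂ {a b : ℕ} {A : Finset ℕ} (hab : a ≠ b) (ha : a ∉ A) (hb : b ∉ A)
    (F : (ℕ → I) → M) :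
    assignmentSum (insert a (insert b A)) F = assignmentSum A fun c =>
      ∑ x : I × I, F (Function.update (Function.update c b x.2) a x.1) := by
  rw [assignmentSum_insert (by simp [hab, ha]), assignmentSum_insert hb]
  refine assignmentSum_congr fun c => ?_
  rw [Finset.sum_comm, Fintype.sum_prod_type]

theorem assignmentSum_insert₃ {a b c : ℕ} {A : Finset ℕ} (hab : a ≠ b) (hac : a ≠ c)
    (hbc : b ≠ c) (ha : a ∉ A) (hb : b ∉ A) (hc : c ∉ A) (F : (ℕ → I) → M) :
    assignmentSum (insert a (insert b (insert c A))) F = assignmentSum A fun k =>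
      ∑ x : I × I × I, F (Function.update (Function.update (Function.update k c x.2.2) b x.2.1)
        a x.1) := by
  rw [assignmentSum_insert₂ hab (by simp [hac, ha]) (by simp [hbc, hb]),
    assignmentSum_insert hc]
  refine assignmentSum_congr fun k => ?_
  rw [Finset.sum_comm]
  simp only [Fintype.sum_prod_type]

theorem assignmentSum_map (σ : Equiv.Perm ℕ) (A : Finset ℕ) (F : (ℕ → I) → M) :
    assignmentSum (A.map σ.toEmbedding) F = assignmentSum A fun c => F (c ∘ σ.symm) := by
  induction A using Finset.induction_on generalizing F with
  | empty => simp [assignmentSum_empty, Function.comp_def]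
  | insert a A ha ih =>
    rw [Finset.map_insert, assignmentSum_insert (by simpa using ha), ih,
      assignmentSum_insert ha]
    refine assignmentSum_congr fun c => Finset.sum_congr rfl fun i _ => ?_
    simp [Function.update_comp_equiv]

end Assignment

/-! ### State sums of words. -/

/-- The labels that occur in a word. -/
def arrowLabels (w : List ArrowEnd) : Finset ℕ := (w.map Prod.fst).toFinset

theorem mem_arrowLabels {a : ℕ} {w : List ArrowEnd} :
    a ∈ arrowLabels w ↔ (a, true) ∈ w ∨ (a, false) ∈ w := by
  simp [arrowLabels, or_comm]

theorem arrowLabels_append (u v : List ArrowEnd) :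
    arrowLabels (u ++ v) = arrowLabels u ∪ arrowLabels v := by
  simp [arrowLabels]

theorem notMem_arrowLabels_of {a : ℕ} {w : List ArrowEnd} (s : Bool) (h : (a, s) ∉ w)
    (h' : (a, !s) ∉ w) : a ∉ arrowLabels w := by
  rw [mem_arrowLabels]
  cases s <;> simp_all

open LabelledSmoothing

section WordMatrix

variable (R : Type*) [CommSemiring R] {N : ℕ} [NeZero N]

/-- The product along a word of the matrices of the labelled smoothings. -/
def wordMatrix (c : ℕ → LabelledSmoothing N) (w : List ArrowEnd) :
    Matrix (ZMod N) (ZMod N) R :=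
  (w.map fun p => (c p.1).matrix R p.2).prod

variable {R} in
@[simp] theorem wordMatrix_nil (c : ℕ → LabelledSmoothing N) : wordMatrix R c [] = 1 := by
  simp [wordMatrix]

@[simp] theorem wordMatrix_cons (c : ℕ → LabelledSmoothing N) (p : ArrowEnd)
    (w : List ArrowEnd) :
    wordMatrix R c (p :: w) = (c p.1).matrix R p.2 * wordMatrix R c w := by
  simp [wordMatrix]

@[simp] theorem wordMatrix_append (c : ℕ → LabelledSmoothing N) (u v : List ArrowEnd) :
    wordMatrix R c (u ++ v) = wordMatrix R c u * wordMatrix R c v := by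
  simp [wordMatrix]

theorem wordMatrix_update {a : ℕ} {w : List ArrowEnd} (ha : a ∉ arrowLabels w)
    (c : ℕ → LabelledSmoothing N) (i : LabelledSmoothing N) :
    wordMatrix R (Function.update c a i) w = wordMatrix R c w := by
  unfold wordMatrix
  congr 1
  refine List.map_congr_left fun p hp => ?_
  rw [Function.update_of_ne]
  rintro rfl
  exact ha (by simp only [arrowLabels, List.mem_toFinset]; exact List.mem_map_of_mem hp)

variable (N) in
/-- The state sum of a word that is cut open at its base point, as a matrix in the labels of its
initial and final edges. -/
def stateMatrix (w : List ArrowEnd) : Matrix (ZMod N) (ZMod N) R :=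
  assignmentSum (arrowLabels w) fun c => wordMatrix R c w

/-- Base point invariance requires cancelling `N`, which is zero modulo two when `N` is even, so the
state sum is also needed over `ℕ`. -/
theorem wordMatrix_map_natCast (c : ℕ → LabelledSmoothing N) (w : List ArrowEnd)
    (i j : ZMod N) : ((wordMatrix ℕ c w i j : ℕ) : R) = wordMatrix R c w i j := by
  induction w generalizing i with
  | nil => simp [Matrix.one_apply]
  | cons p w ih =>
    simp only [wordMatrix_cons, Matrix.mul_apply, Nat.cast_sum, Nat.cast_mul, ih, matrix,
      Matrix.single_apply, Nat.cast_ite, Nat.cast_one, Nat.cast_zero]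

theorem stateMatrix_map_natCast (w : List ArrowEnd) (i j : ZMod N) :
    ((stateMatrix ℕ N w i j : ℕ) : R) = stateMatrix R N w i j := by
  simp only [stateMatrix, assignmentSum, Matrix.sum_apply, Nat.cast_sum, wordMatrix_map_natCast]

/-- Compatibility of labels only involves their differences. -/
theorem wordMatrix_shift (c : ℕ → LabelledSmoothing N) (k : ZMod N) (w : List ArrowEnd)
    (i j : ZMod N) :
    wordMatrix R (fun n => ((c n).1, (c n).2.1 + k, (c n).2.2 + k)) w (i + k) (j + k) =
      wordMatrix R c w i j := by
  induction w generalizing i with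
  | nil => simp [Matrix.one_apply]
  | cons p w ih =>
    simp only [wordMatrix_cons, Matrix.mul_apply]
    rw [← Equiv.sum_comp (Equiv.addRight k)]
    refine Finset.sum_congr rfl fun x _ => ?_
    simp only [Equiv.coe_addRight, ih]
    congr 1
    obtain ⟨a, s⟩ := p
    rcases h : c a with ⟨b, l, m⟩
    cases s <;> cases b <;>
      simp [matrix, inLabel, outLabel, Matrix.single_apply, add_right_comm _ k 1]

theorem stateMatrix_shift (w : List ArrowEnd) (k i j : ZMod N) :
    stateMatrix R N w (i + k) (j + k) = stateMatrix R N w i j := by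
  simp only [stateMatrix, assignmentSum, Matrix.sum_apply]
  let e : LabelledSmoothing N ≃ LabelledSmoothing N :=
    (Equiv.refl Bool).prodCongr ((Equiv.addRight k).prodCongr (Equiv.addRight k))
  rw [← (Equiv.piCongrRight fun _ : arrowLabels w => e).sum_comp]
  refine Finset.sum_congr rfl fun c _ => ?_
  rw [← wordMatrix_shift R (extendDefault _ c) k]
  unfold wordMatrix
  refine congrArg (fun l : List (Matrix (ZMod N) (ZMod N) R) => l.prod (i + k) (j + k))
    (List.map_congr_left fun p hp => ?_)
  have : p.1 ∈ arrowLabels w := by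
    simp only [arrowLabels, List.mem_toFinset]; exact List.mem_map_of_mem hp
  simp [extendDefault, this, e, Prod.map]

theorem card_mul_stateMatrix (w : List ArrowEnd) :
    N * stateMatrix ℕ N w 0 0 = (stateMatrix ℕ N w).trace := by
  have h : ∀ k, stateMatrix ℕ N w k k = stateMatrix ℕ N w 0 0 := fun k => by
    simpa using stateMatrix_shift ℕ w k 0 0
  simp [Matrix.trace, h]

/-- The trace is cyclic, and by translation symmetry it is `N` times any diagonal entry. -/
theorem stateMatrix_rotate (u v : List ArrowEnd) :
    stateMatrix ℕ N (u ++ v) 0 0 = stateMatrix ℕ N (v ++ u) 0 0 := by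
  refine Nat.eq_of_mul_eq_mul_left (Nat.pos_of_ne_zero (NeZero.ne N)) ?_
  rw [card_mul_stateMatrix, card_mul_stateMatrix]
  have h : arrowLabels (u ++ v) = arrowLabels (v ++ u) := by
    ext; simp [mem_arrowLabels]; tauto
  unfold stateMatrix
  rw [h]
  simp only [assignmentSum, Matrix.trace_sum, wordMatrix_append]
  exact Finset.sum_congr rfl fun c _ =>
    Matrix.trace_mul_comm (wordMatrix ℕ _ u) (wordMatrix ℕ _ v)

theorem stateMatrix_relabel (σ : Equiv.Perm ℕ) (w : List ArrowEnd) :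
    stateMatrix R N (w.map fun p => (σ p.1, p.2)) = stateMatrix R N w := by
  have h : arrowLabels (w.map fun p => (σ p.1, p.2)) = (arrowLabels w).map σ.toEmbedding := by
    ext a
    simp only [mem_arrowLabels, Finset.mem_map_equiv, List.mem_map, Prod.mk.injEq]
    constructor
    · rintro (⟨⟨b, s⟩, h, rfl, rfl⟩ | ⟨⟨b, s⟩, h, rfl, rfl⟩) <;> simp [h]
    · rintro (h | h)
      · exact Or.inl ⟨_, h, by simp⟩
      · exact Or.inr ⟨_, h, by simp⟩
  rw [stateMatrix, h, assignmentSum_map]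
  refine assignmentSum_congr fun c => ?_
  simp [wordMatrix, Function.comp_def]

end WordMatrix

/-! ### Invariance of the state sum under the moves. -/

section Moves

variable {N : ℕ} [NeZero N]

theorem stateMatrix_kink (hN : Even N) {a : ℕ} {s : Bool} {w : List ArrowEnd}
    (h : ((a, s) :: (a, !s) :: w).Nodup) :
    stateMatrix (ZMod 2) N ((a, s) :: (a, !s) :: w) = stateMatrix (ZMod 2) N w := by
  have ha : a ∉ arrowLabels w := notMem_arrowLabels_of s (by simp_all) (by simp_all)
  have hl : arrowLabels ((a, s) :: (a, !s) :: w) = insert a (arrowLabels w) := by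
    simp [arrowLabels]
  rw [stateMatrix, hl, assignmentSum_insert ha]
  refine assignmentSum_congr fun c => ?_
  simp only [wordMatrix_cons, Function.update_self, wordMatrix_update _ ha, ← mul_assoc]
  rw [← Finset.sum_mul, sum_matrix_mul_matrix hN, one_mul]

theorem stateMatrix_parallel (hN : Even N) {a b : ℕ} {s : Bool} {u v : List ArrowEnd}
    (h : ([(a, s), (b, !s)] ++ u ++ [(a, !s), (b, s)] ++ v).Nodup) :
    stateMatrix (ZMod 2) N ([(a, s), (b, !s)] ++ u ++ [(a, !s), (b, s)] ++ v) =
      stateMatrix (ZMod 2) N (u ++ v) := by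
  have hab : a ≠ b := by rintro rfl; simp at h
  have hau : a ∉ arrowLabels u := notMem_arrowLabels_of s (by grind) (by grind)
  have hav : a ∉ arrowLabels v := notMem_arrowLabels_of s (by grind) (by grind)
  have hbu : b ∉ arrowLabels u := notMem_arrowLabels_of s (by grind) (by grind)
  have hbv : b ∉ arrowLabels v := notMem_arrowLabels_of s (by grind) (by grind)
  have hl : arrowLabels ([(a, s), (b, !s)] ++ u ++ [(a, !s), (b, s)] ++ v) =
      insert a (insert b (arrowLabels (u ++ v))) := by
    ext; simp [arrowLabels]
  rw [stateMatrix, hl, assignmentSum_insert₂ hab (by simp_all [mem_arrowLabels])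
    (by simp_all [mem_arrowLabels])]
  refine assignmentSum_congr fun c => ?_
  simp only [wordMatrix_cons, wordMatrix_append, wordMatrix_nil, Function.update_self,
    Function.update_of_ne hab.symm, wordMatrix_update _ hau, wordMatrix_update _ hav,
    wordMatrix_update _ hbu, wordMatrix_update _ hbv, mul_one]
  rw [← Finset.sum_mul, sum_matrix_parallel hN]

theorem stateMatrix_antiparallel (hN : Even N) {a b : ℕ} {s : Bool} {u v : List ArrowEnd}
    (h : ([(a, s), (b, !s)] ++ u ++ [(b, s), (a, !s)] ++ v).Nodup) :
    stateMatrix (ZMod 2) N ([(a, s), (b, !s)] ++ u ++ [(b, s), (a, !s)] ++ v) =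
      stateMatrix (ZMod 2) N (u ++ v) := by
  have hab : a ≠ b := by rintro rfl; simp at h
  have hau : a ∉ arrowLabels u := notMem_arrowLabels_of s (by grind) (by grind)
  have hav : a ∉ arrowLabels v := notMem_arrowLabels_of s (by grind) (by grind)
  have hbu : b ∉ arrowLabels u := notMem_arrowLabels_of s (by grind) (by grind)
  have hbv : b ∉ arrowLabels v := notMem_arrowLabels_of s (by grind) (by grind)
  have hl : arrowLabels ([(a, s), (b, !s)] ++ u ++ [(b, s), (a, !s)] ++ v) =
      insert a (insert b (arrowLabels (u ++ v))) := by
    ext; simp [arrowLabels]; tauto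
  rw [stateMatrix, hl, assignmentSum_insert₂ hab (by simp_all [mem_arrowLabels])
    (by simp_all [mem_arrowLabels])]
  refine assignmentSum_congr fun c => ?_
  simp only [wordMatrix_cons, wordMatrix_append, wordMatrix_nil, Function.update_self,
    Function.update_of_ne hab.symm, wordMatrix_update _ hau, wordMatrix_update _ hav,
    wordMatrix_update _ hbu, wordMatrix_update _ hbv, mul_one]
  rw [← Finset.sum_mul, sum_matrix_antiparallel hN]

theorem notMem_arrowLabels_of_triangle {p₁ p₂ q₁ q₂ r₁ r₂ : ArrowEnd} {u v w : List ArrowEnd}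
    (h : ([p₁, p₂] ++ u ++ [q₁, q₂] ++ v ++ [r₁, r₂] ++ w).Nodup) {a : ℕ}
    (ht : (a, true) ∈ [p₁, p₂, q₁, q₂, r₁, r₂]) (hf : (a, false) ∈ [p₁, p₂, q₁, q₂, r₁, r₂]) :
    a ∉ arrowLabels u ∧ a ∉ arrowLabels v ∧ a ∉ arrowLabels w := by
  have h' : ([p₁, p₂, q₁, q₂, r₁, r₂] ++ (u ++ (v ++ w))).Nodup := by
    refine (List.Perm.nodup_iff ?_).1 h
    rw [List.perm_iff_count]
    intro x
    simp only [List.count_append, List.count_cons, List.count_nil]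
    omega
  have hd := List.disjoint_of_nodup_append h'
  have h₁ := hd ht
  have h₂ := hd hf
  simp only [List.mem_append] at h₁ h₂
  simp only [mem_arrowLabels]
  tauto

/-- Two words with the same three arrows outside `u`, `v` and `w` have the same state matrix if
the three pairs of matrices agree in the sense of the Yang-Baxter equation. -/
theorem stateMatrix_triangle {a b c : ℕ} {p₁ p₂ q₁ q₂ r₁ r₂ p₁' p₂' q₁' q₂' r₁' r₂' : ArrowEnd}
    {u v w : List ArrowEnd}
    (hab : a ≠ b) (hac : a ≠ c) (hbc : b ≠ c)
    (ha : a ∉ arrowLabels u ∧ a ∉ arrowLabels v ∧ a ∉ arrowLabels w)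
    (hb : b ∉ arrowLabels u ∧ b ∉ arrowLabels v ∧ b ∉ arrowLabels w)
    (hc : c ∉ arrowLabels u ∧ c ∉ arrowLabels v ∧ c ∉ arrowLabels w)
    (hl : arrowLabels ([p₁, p₂] ++ [q₁, q₂] ++ [r₁, r₂]) = {a, b, c})
    (hl' : arrowLabels ([p₁', p₂'] ++ [q₁', q₂'] ++ [r₁', r₂']) = {a, b, c})
    (hT : ∀ k : ℕ → LabelledSmoothing N, ∀ i₀ i₁ j₀ j₁ k₀ k₁,
      ∑ x : LabelledSmoothing N × LabelledSmoothing N × LabelledSmoothing N,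
        (fun f => wordMatrix (ZMod 2) f [p₁, p₂] i₀ i₁ * wordMatrix (ZMod 2) f [q₁, q₂] j₀ j₁ *
          wordMatrix (ZMod 2) f [r₁, r₂] k₀ k₁)
          (Function.update (Function.update (Function.update k c x.2.2) b x.2.1) a x.1) =
      ∑ x : LabelledSmoothing N × LabelledSmoothing N × LabelledSmoothing N,
        (fun f => wordMatrix (ZMod 2) f [p₁', p₂'] i₀ i₁ *
          wordMatrix (ZMod 2) f [q₁', q₂'] j₀ j₁ * wordMatrix (ZMod 2) f [r₁', r₂'] k₀ k₁)
          (Function.update (Function.update (Function.update k c x.2.2) b x.2.1) a x.1)) :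
    stateMatrix (ZMod 2) N ([p₁, p₂] ++ u ++ [q₁, q₂] ++ v ++ [r₁, r₂] ++ w) =
      stateMatrix (ZMod 2) N ([p₁', p₂'] ++ u ++ [q₁', q₂'] ++ v ++ [r₁', r₂'] ++ w) := by
  have key : ∀ x₁ x₂ y₁ y₂ z₁ z₂ : ArrowEnd,
      arrowLabels ([x₁, x₂] ++ [y₁, y₂] ++ [z₁, z₂]) = {a, b, c} →
      arrowLabels ([x₁, x₂] ++ u ++ [y₁, y₂] ++ v ++ [z₁, z₂] ++ w) =
        insert a (insert b (insert c (arrowLabels (u ++ v ++ w)))) := by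
    intro x₁ x₂ y₁ y₂ z₁ z₂ h
    simp only [arrowLabels_append] at h ⊢
    have h' : ∀ s t z : Finset ℕ, s ∪ arrowLabels u ∪ t ∪ arrowLabels v ∪ z ∪ arrowLabels w =
        s ∪ t ∪ z ∪ (arrowLabels u ∪ arrowLabels v ∪ arrowLabels w) := fun s t z => by ac_rfl
    rw [h', h]
    simp only [Finset.insert_union, Finset.singleton_union]
  have hn : ∀ n, n ∉ arrowLabels u → n ∉ arrowLabels v → n ∉ arrowLabels w →
      n ∉ arrowLabels (u ++ v ++ w) := by
    intro n h₁ h₂ h₃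
    simp only [arrowLabels_append, Finset.mem_union, h₁, h₂, h₃, or_self, not_false_eq_true]
  rw [stateMatrix, stateMatrix, key _ _ _ _ _ _ hl, key _ _ _ _ _ _ hl']
  have ha' := hn a ha.1 ha.2.1 ha.2.2
  have hb' := hn b hb.1 hb.2.1 hb.2.2
  have hc' := hn c hc.1 hc.2.1 hc.2.2
  rw [assignmentSum_insert₃ hab hac hbc ha' hb' hc', assignmentSum_insert₃ hab hac hbc ha' hb' hc']
  refine assignmentSum_congr fun k => ?_
  let f : LabelledSmoothing N × LabelledSmoothing N × LabelledSmoothing N →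
      ℕ → LabelledSmoothing N := fun x =>
    Function.update (Function.update (Function.update k c x.2.2) b x.2.1) a x.1
  have hf : ∀ x {l : List ArrowEnd}, a ∉ arrowLabels l → b ∉ arrowLabels l →
      c ∉ arrowLabels l → wordMatrix (ZMod 2) (f x) l = wordMatrix (ZMod 2) k l := by
    intro x l h₁ h₂ h₃
    rw [wordMatrix_update _ h₁, wordMatrix_update _ h₂, wordMatrix_update _ h₃]
  have := congrArg (· * wordMatrix (ZMod 2) k w) (sum_mul_mul_mul_mul_congr
    (A := fun x => wordMatrix (ZMod 2) (f x) [p₁, p₂])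
    (B := fun x => wordMatrix (ZMod 2) (f x) [q₁, q₂])
    (C := fun x => wordMatrix (ZMod 2) (f x) [r₁, r₂])
    (A' := fun x => wordMatrix (ZMod 2) (f x) [p₁', p₂'])
    (B' := fun x => wordMatrix (ZMod 2) (f x) [q₁', q₂'])
    (C' := fun x => wordMatrix (ZMod 2) (f x) [r₁', r₂']) (hT k)
    (wordMatrix (ZMod 2) k u) (wordMatrix (ZMod 2) k v))
  simp only [Finset.sum_mul] at this
  refine (Finset.sum_congr rfl fun x _ => ?_).trans
    (this.trans (Finset.sum_congr rfl fun x _ => ?_))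
  · rw [wordMatrix_append, wordMatrix_append, wordMatrix_append, wordMatrix_append,
      wordMatrix_append, hf x ha.1 hb.1 hc.1, hf x ha.2.1 hb.2.1 hc.2.1,
      hf x ha.2.2 hb.2.2 hc.2.2]
  · rw [wordMatrix_append, wordMatrix_append, wordMatrix_append, wordMatrix_append,
      wordMatrix_append, hf x ha.1 hb.1 hc.1, hf x ha.2.1 hb.2.1 hc.2.1,
      hf x ha.2.2 hb.2.2 hc.2.2]

/-- The entry of the state matrix at the base label is invariant modulo two under the moves. -/
theorem stateMatrix_eq_of_flatMove (hN : Even N) {w w' : List ArrowEnd} (hw : w.Nodup)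
    (hw' : w'.Nodup) (h : FlatMove w w') :
    stateMatrix (ZMod 2) N w 0 0 = stateMatrix (ZMod 2) N w' 0 0 := by
  cases h with
  | rotate u v =>
    rw [← stateMatrix_map_natCast, stateMatrix_rotate, stateMatrix_map_natCast]
  | relabel σ => rw [stateMatrix_relabel]
  | fr1 a s => rw [stateMatrix_kink hN hw']
  | fr2_parallel a b s u v => rw [stateMatrix_parallel hN hw']
  | fr2_antiparallel a b s u v => rw [stateMatrix_antiparallel hN hw']
  | fr3_acyclic a b c u v w =>
    have hab : a ≠ b := by rintro rfl; simp at hw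
    have hac : a ≠ c := by rintro rfl; simp at hw
    have hbc : b ≠ c := by rintro rfl; simp at hw
    rw [stateMatrix_triangle hab hac hbc]
    iterate 3 exact notMem_arrowLabels_of_triangle hw (by simp) (by simp)
    · ext; simp [arrowLabels]
    · ext; simp [arrowLabels]; tauto
    · intro k i₀ i₁ j₀ j₁ k₀ k₁
      simpa [hab.symm, hac.symm, hbc.symm] using
        acyclic_triangle_entries hN i₀ i₁ j₀ j₁ k₀ k₁
  | fr3_acyclic' a b c u v w =>
    have hab : a ≠ b := by rintro rfl; simp at hw
    have hac : a ≠ c := by rintro rfl; simp at hw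
    have hbc : b ≠ c := by rintro rfl; simp at hw
    rw [stateMatrix_triangle hab hac hbc]
    iterate 3 exact notMem_arrowLabels_of_triangle hw (by simp) (by simp)
    · ext; simp [arrowLabels]; tauto
    · ext; simp [arrowLabels]; tauto
    · intro k i₀ i₁ j₀ j₁ k₀ k₁
      -- The other cyclic order of the branches only exchanges the second and third tensor factors.
      simpa [hab.symm, hac.symm, hbc.symm, mul_right_comm] using
        acyclic_triangle_entries hN i₀ i₁ k₀ k₁ j₀ j₁
  | fr3_cyclic a b c u v w =>
    have hab : a ≠ b := by rintro rfl; simp at hw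
    have hac : a ≠ c := by rintro rfl; simp at hw
    have hbc : b ≠ c := by rintro rfl; simp at hw
    -- The arrows are taken in the order `a`, `c`, `b` to match `cyclic_triangle_entries`.
    rw [stateMatrix_triangle hac hab hbc.symm]
    iterate 3 exact notMem_arrowLabels_of_triangle hw (by simp) (by simp)
    · ext; simp [arrowLabels]; tauto
    · ext; simp [arrowLabels]
    · intro k i₀ i₁ j₀ j₁ k₀ k₁
      simpa [hab.symm, hac.symm, hbc] using
        cyclic_triangle_entries hN i₀ i₁ j₀ j₁ k₀ k₁
  | fr3_cyclic' a b c u v w =>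
    have hab : a ≠ b := by rintro rfl; simp at hw
    have hac : a ≠ c := by rintro rfl; simp at hw
    have hbc : b ≠ c := by rintro rfl; simp at hw
    rw [stateMatrix_triangle hac hab hbc.symm]
    iterate 3 exact notMem_arrowLabels_of_triangle hw (by simp) (by simp)
    · ext; simp [arrowLabels]; tauto
    · ext; simp [arrowLabels]; tauto
    · intro k i₀ i₁ j₀ j₁ k₀ k₁
      simpa [hab.symm, hac.symm, hbc, mul_right_comm] using
        cyclic_triangle_entries hN i₀ i₁ k₀ k₁ j₀ j₁

end Moves

/-! ### Labels modulo two. -/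

/-- With labels modulo two the state sum does not depend on the crossings. -/
theorem stateMatrix_two (w : List ArrowEnd) (hw : w.Nodup)
    (hc : ∀ a b, (a, b) ∈ w → (a, !b) ∈ w) : stateMatrix (ZMod 2) 2 w = 1 := by
  induction hn : w.length using Nat.strong_induction_on generalizing w with
  | _ n ih =>
    match w with
    | [] => simp [stateMatrix, arrowLabels, assignmentSum_empty]
    | (a, s) :: l =>
      have hl : (a, !s) ∈ l := by simpa using hc a s (by simp)
      -- Whatever lies between the ends of the first arrow, the arrow can be deleted.
      obtain ⟨u, v, rfl⟩ := List.append_of_mem hl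
      have hau : a ∉ arrowLabels u := notMem_arrowLabels_of s (by grind) (by grind)
      have hav : a ∉ arrowLabels v := notMem_arrowLabels_of s (by grind) (by grind)
      have hl : arrowLabels ((a, s) :: (u ++ (a, !s) :: v)) =
          insert a (arrowLabels (u ++ v)) := by
        ext; simp [arrowLabels]
      rw [stateMatrix, hl, assignmentSum_insert (by simp_all [mem_arrowLabels])]
      refine Eq.trans ?_ (ih (u ++ v).length (by simp at hn ⊢; omega) (u ++ v) (by grind)
        (fun b t hb => ?_) rfl)
      · refine assignmentSum_congr fun c => ?_
        simp only [wordMatrix_cons, wordMatrix_append, Function.update_self,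
          wordMatrix_update _ hau, wordMatrix_update _ hav, ← mul_assoc]
        rw [← Finset.sum_mul, sum_matrix_mul_mul_matrix_two]
      · have h₁ := hc b t (by simp at hb ⊢; tauto)
        have : b ≠ a := by
          rintro rfl
          simp only [mem_arrowLabels, List.mem_append] at *
          cases t <;> tauto
        simpa [this] using h₁

/-! ### Potentials on the loops of a state. -/

namespace FlatGaussDiagram

variable (D : FlatGaussDiagram) (T : Finset ℕ)

/-- A labelling of the edges of the skeleton that is compatible with the state `T`: it increases by
the cusp sign when passing through a smoothing. -/
def IsPotential {A : Type*} [AddGroupWithOne A] (x : D.HalfEdge → A) : Prop :=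
  (∀ h, x (D.edgeFlip h) = x h) ∧ ∀ h, x (D.smooth T h) = x h + (D.cuspSign T h : A)

variable {D T}

theorem IsPotential.step {A : Type*} [AddGroupWithOne A] {x : D.HalfEdge → A}
    (hx : D.IsPotential T x) (h : D.HalfEdge) :
    x (D.step T h) = x h + (D.cuspSign T h : A) := by
  rw [step_apply, hx.1, hx.2]

open Classical in
theorem sum_cycle_step {A : Type*} [AddCommMonoid A] (f : D.HalfEdge → A) (h : D.HalfEdge) :
    ∑ h', (if (D.step T).SameCycle h h' then f (D.step T h') else 0) =
      ∑ h', if (D.step T).SameCycle h h' then f h' else 0 := by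
  rw [← Equiv.sum_comp (D.step T) fun h' => if (D.step T).SameCycle h h' then f h' else 0]
  simp only [Equiv.Perm.sameCycle_apply_right]

/-- The cusp sum vanishes in a group in which the cusp signs are the increments of a function. -/
theorem cuspSum_cast_eq_zero {A : Type*} [AddCommGroupWithOne A] {x : D.HalfEdge → A}
    (hx : ∀ h, x (D.step T h) = x h + (D.cuspSign T h : A)) (h : D.HalfEdge) :
    (D.cuspSum T h : A) = 0 := by
  classical
  have := sum_cycle_step x h (T := T)
  simp only [hx] at this
  have h' : ∀ h', (if (D.step T).SameCycle h h' then x h' + (D.cuspSign T h' : A) else 0) =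
      (if (D.step T).SameCycle h h' then x h' else 0) +
        if (D.step T).SameCycle h h' then (D.cuspSign T h' : A) else 0 := by
    intro h'; split_ifs <;> simp
  -- The increments telescope around the cycle.
  simp only [h', Finset.sum_add_distrib, add_eq_left] at this
  simp only [cuspSum, Int.cast_sum]
  rw [← this]
  refine Finset.sum_congr rfl fun h' _ => ?_
  split_ifs <;> simp

/-- The direction of travel relative to the skeleton is reversed exactly at the cusps, so it is a
function modulo two whose increments are the cusp signs. -/
theorem even_cuspSum (h : D.HalfEdge) : Even (D.cuspSum T h) := by
  rw [← ZMod.intCast_eq_zero_iff_even]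
  refine cuspSum_cast_eq_zero (x := fun h => if h.2 then (1 : ZMod 2) else 0) ?_ h
  have h2 : (1 : ZMod 2) + 1 = 0 := rfl
  rintro ⟨_ | p, b⟩
  · cases b <;> simp [step_apply, smooth, edgeFlip, cuspSign]
  · by_cases hp : p.1.1 ∈ T <;> cases b <;>
      simp [step_apply, smooth, edgeFlip, cuspSign, hp, h2]

theorem abs_cuspSum_le (h : D.HalfEdge) : |D.cuspSum T h| ≤ Fintype.card D.HalfEdge := by
  classical
  unfold cuspSum
  refine (Finset.abs_sum_le_sum_abs _ _).trans ?_
  rw [Fintype.card, Finset.card_eq_sum_ones, Nat.cast_sum]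
  refine Finset.sum_le_sum fun h' _ => ?_
  split_ifs
  · obtain ⟨_ | p, b⟩ := h'
    · simp [cuspSign]
    · simp only [cuspSign]
      split_ifs <;> simp
  · simp

/-- A function on half-edges that is invariant along loops is constant if there is one loop. -/
theorem eq_of_subsingleton_loop [Subsingleton (D.Loop T)] {α : Type*} (g : D.HalfEdge → α)
    (he : ∀ h, g (D.edgeFlip h) = g h) (hs : ∀ h, g (D.smooth T h) = g h) (h h' : D.HalfEdge) :
    g h = g h' := by
  have : ∀ C C' : D.Loop T, Quot.lift g (by rintro a b (rfl | rfl) <;> simp [he, hs]) C =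
      Quot.lift g (by rintro a b (rfl | rfl) <;> simp [he, hs]) C' := fun C C' => by
    rw [Subsingleton.elim C C']
  exact this (Quot.mk _ h) (Quot.mk _ h')

/-- The walk of length `orderOf (D.step T)` goes around the loop a whole number of times. Its total
is constant on the cycle, and the sum of these totals over the cycle is a sum of cusp sums. -/
theorem sum_range_orderOf_eq_zero (h₀ : ∀ h, D.cuspSum T h = 0) (h : D.HalfEdge) :
    ∑ i ∈ Finset.range (orderOf (D.step T)), D.cuspSign T ((D.step T ^ i) h) = 0 := by
  classical
  set L := orderOf (D.step T) with hL
  set tot : D.HalfEdge → ℤ := fun h => ∑ i ∈ Finset.range L, D.cuspSign T ((D.step T ^ i) h)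
  have hiter : ∀ (i : ℕ) (f : D.HalfEdge → ℤ),
      ∑ h', (if (D.step T).SameCycle h h' then f ((D.step T ^ i) h') else 0) =
        ∑ h', if (D.step T).SameCycle h h' then f h' else 0 := by
    intro i
    induction i with
    | zero => simp
    | succ i ih =>
      intro f
      have := sum_cycle_step (fun h' => f ((D.step T ^ i) h')) h (T := T)
      rw [ih] at this
      simpa only [pow_succ, Equiv.Perm.mul_apply] using this
  have hstep : ∀ h', tot (D.step T h') = tot h' := by
    intro h'
    have h₁ := Finset.sum_range_succ (fun i => D.cuspSign T ((D.step T ^ i) h')) L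
    have h₂ := Finset.sum_range_succ' (fun i => D.cuspSign T ((D.step T ^ i) h')) L
    rw [h₁, hL, pow_orderOf_eq_one, ← hL] at h₂
    simp only [pow_succ, Equiv.Perm.mul_apply, pow_zero, add_left_inj] at h₂
    exact h₂.symm
  have hconst : ∀ h', (D.step T).SameCycle h h' → tot h' = tot h := by
    intro h' hh
    obtain ⟨n, -, -, rfl⟩ := hh.exists_pow_eq
    clear hh
    induction n with
    | zero => rfl
    | succ n ih => rw [pow_succ', Equiv.Perm.mul_apply, hstep, ih]
  have hsum : ∑ h', (if (D.step T).SameCycle h h' then tot h' else 0) = 0 := by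
    have : ∀ h', (if (D.step T).SameCycle h h' then tot h' else 0) = ∑ i ∈ Finset.range L,
        if (D.step T).SameCycle h h' then D.cuspSign T ((D.step T ^ i) h') else 0 := by
      intro h'; split_ifs <;> simp [tot]
    simp only [this]
    rw [Finset.sum_comm]
    refine Finset.sum_eq_zero fun i _ => ?_
    rw [hiter]
    exact h₀ h
  have hcard : ∑ h', (if (D.step T).SameCycle h h' then tot h' else 0) =
      (Finset.univ.filter ((D.step T).SameCycle h)).card * tot h := by
    rw [← Finset.sum_filter, Finset.sum_congr rfl fun h' hh => hconst h' (by simpa using hh)]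
    simp
  rw [hcard] at hsum
  refine (mul_eq_zero.1 hsum).resolve_left ?_
  exact Nat.cast_ne_zero.2 (Finset.card_ne_zero.2 ⟨h, by simp [Equiv.Perm.SameCycle.refl]⟩)

/-- The states with one loop without cusp multiplicity have an integral potential. -/
theorem exists_isPotential [Subsingleton (D.Loop T)] (h₀ : ∀ h, D.cuspSum T h = 0) :
    ∃ x : D.HalfEdge → ℤ, D.IsPotential T x := by
  set L := orderOf (D.step T) with hL
  have hLpos : 0 < L := orderOf_pos _
  -- As the total of the signs is zero, a step changes this first moment by `L` times the cusp sign.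
  -- So `y` is `L` times a potential, up to a constant.
  set y : D.HalfEdge → ℤ := fun h =>
    ∑ i ∈ Finset.range L, (i : ℤ) * D.cuspSign T ((D.step T ^ i) h) with hy
  have tot := sum_range_orderOf_eq_zero h₀
  have hystep : ∀ h, y (D.step T h) = y h + L * D.cuspSign T h := by
    intro h
    have h₁ := Finset.sum_range_succ (fun i => (i : ℤ) * D.cuspSign T ((D.step T ^ i) h)) L
    have h₂ := Finset.sum_range_succ' (fun i => (i : ℤ) * D.cuspSign T ((D.step T ^ i) h)) L
    have h₃ := tot (D.step T h)
    rw [h₁, hL, pow_orderOf_eq_one, ← hL] at h₂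
    simp only [pow_succ, Equiv.Perm.mul_apply, Nat.cast_add, Nat.cast_one, add_mul, one_mul,
      Nat.cast_zero, zero_mul, add_zero, Finset.sum_add_distrib, Equiv.Perm.one_apply] at h₂
    rw [← hL] at h₃
    rw [h₃, add_zero] at h₂
    exact h₂.symm
  -- Gluing reverses the walk and the signs, so the sum is reflected.
  have hysmooth : ∀ h, y (D.smooth T h) = y h + L * D.cuspSign T h := by
    intro h
    have hconj : ∀ i < L, (D.step T ^ i) (D.smooth T h) =
        D.smooth T ((D.step T ^ (L - i)) h) := by
      intro i hi
      have hinv : (D.step T)⁻¹ ^ i = D.step T ^ (L - i) := by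
        rw [inv_pow, inv_eq_iff_mul_eq_one, ← pow_add, Nat.add_sub_cancel' hi.le, hL,
          pow_orderOf_eq_one]
      rw [← hinv, ← conj_step, conj_pow]
      simp only [Equiv.Perm.mul_apply, Function.Involutive.toPerm_symm, Equiv.Perm.inv_def,
        Function.Involutive.coe_toPerm]
      rw [D.smooth_involutive T]
    have h₁ : y (D.smooth T h) = ∑ i ∈ Finset.range L,
        -((i : ℤ) * D.cuspSign T ((D.step T ^ (L - i)) h)) := by
      refine Finset.sum_congr rfl fun i hi => ?_
      rw [hconj i (Finset.mem_range.1 hi), cuspSign_smooth, mul_neg]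
    rw [h₁, ← Finset.sum_range_reflect]
    have h₂ : ∀ j ∈ Finset.range L,
        -(((L - 1 - j : ℕ) : ℤ) * D.cuspSign T ((D.step T ^ (L - (L - 1 - j))) h)) =
          (j : ℤ) * D.cuspSign T ((D.step T ^ j) (D.step T h)) -
            (L - 1) * D.cuspSign T ((D.step T ^ j) (D.step T h)) := by
      intro j hj
      have hj' := Finset.mem_range.1 hj
      have e₁ : L - (L - 1 - j) = j + 1 := by omega
      have e₂ : ((L - 1 - j : ℕ) : ℤ) = L - 1 - j := by omega
      rw [e₁, e₂, pow_succ, Equiv.Perm.mul_apply]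
      ring
    rw [Finset.sum_congr rfl h₂, Finset.sum_sub_distrib, ← Finset.mul_sum, tot, mul_zero,
      sub_zero]
    exact hystep h
  have hyflip : ∀ h, y (D.edgeFlip h) = y h := by
    intro h
    rw [← D.step_smooth T, hystep, hysmooth, cuspSign_smooth]
    ring
  -- Modulo `L` the function `y` is constant along loops, and there is only one loop.
  have hdvd : ∀ h, ∃ x, y h - y (none, true) = L * x := by
    intro h
    refine (ZMod.intCast_zmod_eq_zero_iff_dvd _ L).1 ?_
    rw [Int.cast_sub, sub_eq_zero]
    exact eq_of_subsingleton_loop (T := T) (fun h => (y h : ZMod L)) (by simp [hyflip])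
      (by simp [hysmooth]) _ _
  choose x hx using hdvd
  have hL0 : (L : ℤ) ≠ 0 := by exact_mod_cast hLpos.ne'
  refine ⟨x, fun h => ?_, fun h => ?_⟩
  · apply mul_left_cancel₀ hL0
    rw [← hx, ← hx, hyflip]
  · apply mul_left_cancel₀ hL0
    rw [Int.cast_id, mul_add, ← hx, ← hx, hysmooth]
    ring

/-- The loop of a half-edge. -/
def loopMk (T : Finset ℕ) (h : D.HalfEdge) : D.Loop T := Quot.mk _ h

theorem loopMk_edgeFlip (h : D.HalfEdge) : loopMk T (D.edgeFlip h) = loopMk T h :=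
  (Quot.sound (r := fun h h' : D.HalfEdge => h' = D.edgeFlip h ∨ h' = D.smooth T h)
    (Or.inl rfl)).symm

theorem loopMk_smooth (h : D.HalfEdge) : loopMk T (D.smooth T h) = loopMk T h :=
  (Quot.sound (r := fun h h' : D.HalfEdge => h' = D.edgeFlip h ∨ h' = D.smooth T h)
    (Or.inr rfl)).symm

theorem loopMk_surjective : Function.Surjective (loopMk (D := D) T) := Quot.mk_surjective

instance : Nonempty (D.Loop T) := ⟨loopMk T (none, true)⟩

theorem subsingleton_loop_of_card (h : Fintype.card (D.Loop T) = 1) :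
    Subsingleton (D.Loop T) := Fintype.card_le_one_iff_subsingleton.1 h.le

open Classical in
/-- With an even number of labels, the number of normalized labellings of a state is odd exactly if
the state has a single loop and a labelling. -/
theorem natCast_card_isPotential {N : ℕ} [NeZero N] (hN : Even N) :
    ((Fintype.card {x : D.HalfEdge → ZMod N // D.IsPotential T x ∧ x (none, true) = 0} : ℕ) :
      ZMod 2) =
      if Fintype.card (D.Loop T) = 1 ∧ ∃ x : D.HalfEdge → ZMod N, D.IsPotential T x then 1
      else 0 := by
  by_cases hx : ∃ x : D.HalfEdge → ZMod N, D.IsPotential T x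
  swap
  · have : IsEmpty {x : D.HalfEdge → ZMod N // D.IsPotential T x ∧ x (none, true) = 0} :=
      ⟨fun x => hx ⟨x.1, x.2.1⟩⟩
    simp [hx]
  simp only [hx, and_true]
  obtain ⟨x, hx⟩ := hx
  let l₀ : D.Loop T := loopMk T (none, true)
  -- Two potentials differ by a function on the loops. The correction by `x (none, true)` is needed
  -- because the reference potential is not normalized.
  let e : {x : D.HalfEdge → ZMod N // D.IsPotential T x ∧ x (none, true) = 0} ≃
      {g : D.Loop T → ZMod N // g l₀ = 0} :=
    { toFun := fun z => ⟨Quot.lift (fun h => z.1 h - x h + x (none, true)) (by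
          rintro a b (rfl | rfl)
          · simp [hx.1, z.2.1.1]
          · simp [hx.2, z.2.1.2]), by simp [l₀, loopMk, z.2.2]⟩
      invFun := fun g => ⟨fun h => g.1 (loopMk T h) + x h - x (none, true),
        ⟨fun h => by simp only [hx.1, loopMk_edgeFlip],
          fun h => by simp only [hx.2, loopMk_smooth]; ring⟩, by
          have : g.1 (loopMk T (none, true)) = 0 := g.2
          simp [this]⟩
      left_inv := fun z => by
        ext h
        show z.1 h - x h + x (none, true) + x h - x (none, true) = z.1 h
        ring
      right_inv := fun g => by
        ext l
        obtain ⟨h, rfl⟩ := loopMk_surjective l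
        show g.1 (loopMk T h) + x h - x (none, true) - x h + x (none, true) = g.1 (loopMk T h)
        ring }
  rw [Fintype.card_congr e]
  have hcard : Fintype.card {g : D.Loop T → ZMod N // g l₀ = 0} =
      ∏ l : D.Loop T, if l = l₀ then 1 else N := by
    have : (Finset.univ.filter fun g : D.Loop T → ZMod N => g l₀ = 0) =
        Fintype.piFinset fun l => if l = l₀ then {0} else Finset.univ := by
      ext g
      simp only [Finset.mem_filter, Finset.mem_univ, true_and, Fintype.mem_piFinset]
      constructor
      · intro h l
        split_ifs with hl <;> simp [hl, h]
      · intro h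
        simpa using h l₀
    rw [Fintype.card_subtype, this, Fintype.card_piFinset]
    refine Finset.prod_congr rfl fun l _ => ?_
    split_ifs <;> simp [ZMod.card]
  rw [hcard]
  split_ifs with h1
  · have := subsingleton_loop_of_card h1
    simp [Subsingleton.elim _ l₀]
  · have : 1 < Fintype.card (D.Loop T) :=
      lt_of_le_of_ne (Fintype.card_pos) (Ne.symm h1)
    obtain ⟨l, hl⟩ := Fintype.exists_ne_of_one_lt_card this l₀
    rw [Nat.cast_prod]
    -- Each loop other than that of the base point contributes the even factor `N`.
    refine Finset.prod_eq_zero (Finset.mem_univ l) ?_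
    simp [hl, (ZMod.natCast_eq_zero_iff_even).2 hN]

theorem exists_isPotential_zmod [Subsingleton (D.Loop T)] (h₀ : ∀ h, D.cuspSum T h = 0) (N : ℕ) :
    ∃ x : D.HalfEdge → ZMod N, D.IsPotential T x := by
  obtain ⟨x, hx⟩ := exists_isPotential h₀
  exact ⟨fun h => x h, fun h => by simp [hx.1], fun h => by simp [hx.2]⟩

/-- With sufficiently many labels, only the states without cusp multiplicity have a labelling. -/
theorem exists_isPotential_iff [Subsingleton (D.Loop T)] {N : ℕ}
    (hN : Fintype.card D.HalfEdge < N) :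
    (∃ x : D.HalfEdge → ZMod N, D.IsPotential T x) ↔ ∀ h, D.cuspSum T h = 0 := by
  refine ⟨fun ⟨x, hx⟩ h => ?_, fun h₀ => exists_isPotential_zmod h₀ N⟩
  have h₁ := cuspSum_cast_eq_zero hx.step h
  rw [ZMod.intCast_zmod_eq_zero_iff_dvd] at h₁
  refine Int.eq_zero_of_abs_lt_dvd h₁ ((abs_cuspSum_le h).trans_lt ?_)
  exact_mod_cast hN

/-- Evenness of the cusp sum excludes multiplicity one, which truncated division would also send to
zero. -/
theorem cuspMultiplicity_div_two_eq_zero_iff (h : D.HalfEdge) :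
    D.cuspMultiplicity T (loopMk T h) / 2 = 0 ↔ D.cuspSum T h = 0 := by
  have : D.cuspMultiplicity T (loopMk T h) = (D.cuspSum T h).natAbs := rfl
  rw [this]
  obtain ⟨k, hk⟩ := even_cuspSum h (T := T)
  omega

theorem constantCoeff_arrowVar (n : ℕ) :
    MvPolynomial.constantCoeff (arrowVar n) = if n = 0 then 1 else 0 := by
  unfold arrowVar
  split_ifs with h₁ h₂
  · omega
  · exact MvPolynomial.constantCoeff_X _ _
  · exact map_one _
  · omega

open Classical in
/-- Modulo two, the constant term counts the states with one loop without cusp multiplicity. -/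
theorem constantCoeff_arrowPolynomial :
    ((MvPolynomial.constantCoeff D.arrowPolynomial : ℤ) : ZMod 2) =
      ∑ T ∈ D.arrows.powerset,
        if Fintype.card (D.Loop T) = 1 ∧ ∀ h, D.cuspSum T h = 0 then 1 else 0 := by
  have h2 : (2 : ZMod 2) = 0 := rfl
  simp only [arrowPolynomial, stateEval, map_sum, map_mul, map_pow, map_neg, map_ofNat,
    Int.cast_sum, Int.cast_mul, Int.cast_pow, Int.cast_neg, Int.cast_ofNat, h2, neg_zero]
  refine Finset.sum_congr rfl fun T _ => ?_
  by_cases hT : Fintype.card (D.Loop T) = 1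
  · simp only [hT, true_and, map_prod, constantCoeff_arrowVar, Int.cast_prod]
    split_ifs with h₀
    · rw [Finset.prod_eq_one]
      · simp
      · intro C _
        obtain ⟨h, rfl⟩ := loopMk_surjective C
        rw [if_pos ((cuspMultiplicity_div_two_eq_zero_iff _).2 (h₀ _))]
        simp
    · push Not at h₀
      obtain ⟨h, hh⟩ := h₀
      refine mul_eq_zero_of_right _ (Finset.prod_eq_zero (Finset.mem_univ (loopMk T h)) ?_)
      rw [if_neg fun hc => hh ((cuspMultiplicity_div_two_eq_zero_iff _).1 hc)]
      simp
  · have : 1 ≤ Fintype.card (D.Loop T) := Fintype.card_pos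
    rw [zero_pow (by omega)]
    simp [hT]

end FlatGaussDiagram

/-! ### Products of matrix units along a cyclic word. -/

section FormPerm

variable {α β : Type*}

/-- A condition on all cyclically adjacent pairs is a chain condition on the list cut open at `a`,
together with one closing condition. -/
theorem forall_formPerm_iff [DecidableEq α] {a : α} {l : List α} (hl : (a :: l).Nodup)
    (hmem : ∀ x, x ∈ a :: l) (f g : α → β) :
    (∀ x, g x = f ((a :: l).formPerm x)) ↔
      List.IsChain (fun x y => g x = f y) (a :: l) ∧
        g ((a :: l).getLast (List.cons_ne_nil a l)) = f a := by
  rw [List.isChain_iff_getElem]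
  constructor
  · refine fun h => ⟨fun i hi => ?_, ?_⟩
    · rw [h, List.formPerm_apply_lt_getElem _ hl _ hi]
    · rw [h, List.formPerm_apply_getLast]
  · rintro ⟨h, h'⟩ x
    obtain ⟨i, hi, rfl⟩ := List.getElem_of_mem (hmem x)
    by_cases hi' : i + 1 < (a :: l).length
    · rw [List.formPerm_apply_lt_getElem _ hl _ hi', h]
    · have : (a :: l)[i] = (a :: l).getLast (List.cons_ne_nil a l) := by
        rw [List.getLast_eq_getElem]
        congr 1
        omega
      rw [this, List.formPerm_apply_getLast, h']

theorem prod_single_apply [Fintype β] [DecidableEq β] (f g : α → β) (l : List α) (a : α) (k : β) :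
    (l.map fun x => Matrix.single (f x) (g x) (1 : ℕ)).prod (g a) k =
      if List.IsChain (fun x y => g x = f y) (a :: l) ∧
        g ((a :: l).getLast (List.cons_ne_nil a l)) = k then 1 else 0 := by
  classical
  induction l generalizing a with
  | nil => simp [Matrix.one_apply]
  | cons b l ih =>
    rw [List.map_cons, List.prod_cons, Matrix.mul_apply, Finset.sum_eq_single (g b), ih]
    · by_cases h : g a = f b
      · simp [h]
      · simp [h, Ne.symm h]
    · intro x _ hx
      simp [hx.symm]
    · simp

end FormPerm

/-! ### The state sum as a count of potentials. -/

namespace FlatGaussDiagram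

variable {D : FlatGaussDiagram} {N : ℕ}

/-- The label of the edge into a marked point; the base point carries the label zero. -/
def incomingLabel (D : FlatGaussDiagram) (c : ℕ → LabelledSmoothing N) : D.Pt → ZMod N
  | none => 0
  | some p => (c p.1.1).inLabel p.1.2

/-- The label of the edge out of a marked point; the base point carries the label zero. -/
def outgoingLabel (D : FlatGaussDiagram) (c : ℕ → LabelledSmoothing N) : D.Pt → ZMod N
  | none => 0
  | some p => (c p.1.1).outLabel p.1.2

theorem nodup_pts (D : FlatGaussDiagram) : (none :: D.word.attach.map some : List D.Pt).Nodup := by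
  rw [List.nodup_cons]
  refine ⟨by simp, ?_⟩
  exact (List.nodup_attach.2 D.nodup).map (Option.some_injective _)

theorem mem_pts (D : FlatGaussDiagram) (x : D.Pt) :
    x ∈ (none :: D.word.attach.map some : List D.Pt) := by
  cases x <;> simp

/-- A product of matrix units is nonzero only if consecutive labels agree. Taking the entry at `0 0`
amounts to giving the base point label zero on both sides. -/
theorem wordMatrix_word [NeZero N] (c : ℕ → LabelledSmoothing N)
    [Decidable (∀ x, D.outgoingLabel c x = D.incomingLabel c (D.succ x))] :
    wordMatrix ℕ c D.word 0 0 =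
      if ∀ x, D.outgoingLabel c x = D.incomingLabel c (D.succ x) then 1 else 0 := by
  classical
  have h := prod_single_apply (D.incomingLabel c) (D.outgoingLabel c) (D.word.attach.map some)
    none 0
  have h' := forall_formPerm_iff D.nodup_pts D.mem_pts (D.incomingLabel c) (D.outgoingLabel c)
  have h₀ : D.word.map (fun p => (c p.1).matrix ℕ p.2) =
      (D.word.attach.map some).map fun x =>
        Matrix.single (D.incomingLabel c x) (D.outgoingLabel c x) (1 : ℕ) := by
    rw [List.map_map]
    conv_lhs => rw [← List.attach_map_subtype_val D.word, List.map_map]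
    rfl
  rw [wordMatrix, h₀]
  refine h.trans ?_
  simp only [succ, h']
  rfl

/-- The labelling of the half-edges given by an assignment of labelled smoothings. -/
def halfEdgeLabel (D : FlatGaussDiagram) (c : ℕ → LabelledSmoothing N) (h : D.HalfEdge) : ZMod N :=
  if h.2 then D.outgoingLabel c h.1 else D.incomingLabel c h.1

theorem mem_arrows_of_mem {a : ℕ} {s : Bool} (h : (a, s) ∈ D.word) : a ∈ D.arrows := by
  simp only [arrows, List.mem_toFinset]
  exact List.mem_map_of_mem (f := Prod.fst) h

theorem tail_mem_word {a : ℕ} (h : a ∈ D.arrows) : (a, true) ∈ D.word := by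
  rcases mem_arrowLabels.1 h with h | h
  · exact h
  · exact D.closed _ _ h

theorem isPotential_halfEdgeLabel {T : Finset ℕ} {c : ℕ → LabelledSmoothing N}
    (hc : ∀ x, D.outgoingLabel c x = D.incomingLabel c (D.succ x))
    (hT : ∀ a ∈ D.arrows, a ∈ T ↔ (c a).1 = true) :
    D.IsPotential T (D.halfEdgeLabel c) := by
  refine ⟨?_, ?_⟩
  · rintro ⟨x, _ | _⟩
    · simp [halfEdgeLabel, edgeFlip, hc]
    · simp [halfEdgeLabel, edgeFlip, hc]
  · rintro ⟨_ | ⟨⟨a, s⟩, hp⟩, b⟩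
    · cases b <;> simp [halfEdgeLabel, smooth, incomingLabel, outgoingLabel, cuspSign]
    · have := hT a (mem_arrows_of_mem hp)
      by_cases ha : a ∈ T
      · have h' := this.1 ha
        cases s <;> cases b <;> simp [halfEdgeLabel, smooth, incomingLabel, outgoingLabel, cuspSign,
          ha, h', partner, inLabel, outLabel]
      · have h' : (c a).1 = false := by simpa using fun h => ha (this.2 h)
        cases s <;> cases b <;> simp [halfEdgeLabel, smooth, incomingLabel, outgoingLabel, cuspSign,
          ha, h', partner, inLabel, outLabel]

/-- The labelled smoothings given by a state and a labelling of the half-edges. -/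
def labelledSmoothingOf (T : Finset ℕ) (x : D.HalfEdge → ZMod N) (a : D.arrows) :
    LabelledSmoothing N :=
  (decide (a.1 ∈ T), x (some ⟨(a.1, true), tail_mem_word a.2⟩, false),
    -- The outgoing edge at the tail carries `j + 1` after a disoriented smoothing.
    if a.1 ∈ T then x (some ⟨(a.1, true), tail_mem_word a.2⟩, true) - 1
    else x (some ⟨(a.1, true), tail_mem_word a.2⟩, true))

/-- The values of a potential at the tails determine those at the heads through the gluing
condition. -/
theorem halfEdgeLabel_labelledSmoothingOf {T : Finset ℕ} {x : D.HalfEdge → ZMod N}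
    (hx : D.IsPotential T x) (h₀ : x (none, true) = 0) :
    D.halfEdgeLabel (extendDefault D.arrows (labelledSmoothingOf T x)) = x := by
  ext ⟨_ | ⟨⟨a, s⟩, hp⟩, b⟩
  · have := hx.2 (none, true)
    simp only [smooth, h₀, cuspSign] at this
    cases b <;> simp_all [halfEdgeLabel, incomingLabel, outgoingLabel]
  · have ha := mem_arrows_of_mem hp
    have h₁ := hx.2 (some ⟨(a, true), tail_mem_word ha⟩, true)
    have h₂ := hx.2 (some ⟨(a, true), tail_mem_word ha⟩, false)
    by_cases hT : a ∈ T <;>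
      simp only [smooth, cuspSign, hT, partner, if_true, if_false, Bool.not_true,
        Bool.not_false, Bool.true_eq_false] at h₁ h₂ <;>
      cases s <;> cases b <;> simp [halfEdgeLabel, incomingLabel, outgoingLabel, inLabel, outLabel,
        extendDefault, ha, labelledSmoothingOf, hT, h₁, h₂, sub_eq_add_neg]

theorem labelledSmoothingOf_halfEdgeLabel {T : Finset ℕ} (c : D.arrows → LabelledSmoothing N)
    (hT : ∀ a ∈ D.arrows, a ∈ T ↔ (extendDefault D.arrows c a).1 = true) :
    labelledSmoothingOf T (D.halfEdgeLabel (extendDefault D.arrows c)) = c := by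
  ext1 ⟨a, ha⟩
  have := hT a ha
  simp only [extendDefault, ha, dif_pos] at this
  rcases hc : c ⟨a, ha⟩ with ⟨b, i, j⟩
  cases b <;> simp [labelledSmoothingOf, halfEdgeLabel, incomingLabel, outgoingLabel, inLabel,
    outLabel, extendDefault, ha, hc, this]

open Classical in
/-- The state sum counts the normalized labellings of all states. -/
theorem stateMatrix_word [NeZero N] :
    stateMatrix ℕ N D.word 0 0 = ∑ T ∈ D.arrows.powerset,
      Fintype.card {x : D.HalfEdge → ZMod N // D.IsPotential T x ∧ x (none, true) = 0} := by
  have h₀ : stateMatrix ℕ N D.word 0 0 = (Finset.univ.filter fun c : D.arrows →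
      LabelledSmoothing N => ∀ x, D.outgoingLabel (extendDefault D.arrows c) x =
        D.incomingLabel (extendDefault D.arrows c) (D.succ x)).card := by
    rw [Finset.card_filter]
    change (assignmentSum D.arrows fun c => wordMatrix ℕ c D.word) 0 0 = _
    simp only [assignmentSum, Matrix.sum_apply, wordMatrix_word]
  -- The assignments are sorted by their underlying state, the set of disoriented smoothings.
  rw [h₀, Finset.card_eq_sum_card_fiberwise (t := D.arrows.powerset)
    (f := fun c => D.arrows.filter fun a => (extendDefault D.arrows c a).1 = true)
    (fun c _ => Finset.mem_coe.2 (Finset.mem_powerset.2 (Finset.filter_subset _ _)))]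
  refine Finset.sum_congr rfl fun T hT => ?_
  rw [Finset.mem_powerset] at hT
  rw [Finset.filter_filter, ← Fintype.card_subtype]
  have hT' : ∀ c : D.arrows → LabelledSmoothing N,
      (D.arrows.filter fun a => (extendDefault D.arrows c a).1 = true) = T →
        ∀ a ∈ D.arrows, a ∈ T ↔ (extendDefault D.arrows c a).1 = true := by
    rintro c rfl a ha
    simp [ha]
  refine Fintype.card_congr
    { toFun := fun c => ⟨D.halfEdgeLabel (extendDefault D.arrows c.1),
        isPotential_halfEdgeLabel c.2.1 (hT' _ c.2.2), rfl⟩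
      invFun := fun x => ⟨labelledSmoothingOf T x.1, fun y => ?_, ?_⟩
      left_inv := fun c => Subtype.ext (labelledSmoothingOf_halfEdgeLabel _ (hT' _ c.2.2))
      right_inv := fun x => Subtype.ext (halfEdgeLabel_labelledSmoothingOf x.2.1 x.2.2) }
  · have h := halfEdgeLabel_labelledSmoothingOf x.2.1 x.2.2
    have h₁ := congrFun h (y, true)
    have h₂ := congrFun h (D.succ y, false)
    have h₃ := x.2.1.1 (y, true)
    simp only [halfEdgeLabel, edgeFlip, if_true, Bool.false_eq_true, if_false] at h₁ h₂ h₃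
    rw [h₁, h₂, h₃]
  · ext a
    by_cases ha : a ∈ D.arrows
    · simp [ha, extendDefault, labelledSmoothingOf]
    · simpa [ha] using fun h => ha (hT h)

/-! ### Checkerboard colorable diagrams. -/

variable {T : Finset ℕ}

theorem even_length_word (D : FlatGaussDiagram) : Even D.word.length := by
  rw [← ZMod.natCast_eq_zero_iff_even, ← List.toFinset_card_of_nodup D.nodup,
    Finset.card_eq_sum_ones, Nat.cast_sum]
  refine Finset.sum_involution (fun p _ => (p.1, !p.2)) ?_ ?_ ?_ ?_
  · intro p _; rfl
  · rintro ⟨a, s⟩ _ _; simp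
  · rintro ⟨a, s⟩ h
    simpa using D.closed a s (by simpa using h)
  · rintro ⟨a, s⟩ _; simp

theorem index_modEq_length (D : FlatGaussDiagram) (a : ℕ) :
    D.index a ≡ (D.interval a).length [ZMOD 2] := by
  have h := List.length_eq_countP_add_countP (fun p : ArrowEnd => p.2) (l := D.interval a)
  have h' : List.countP (fun p : ArrowEnd => decide ¬p.2 = true) (D.interval a) =
      List.countP (fun p : ArrowEnd => !p.2) (D.interval a) := by
    congr 1; ext p; simp
  rw [h'] at h
  unfold index
  rw [h, Int.modEq_iff_dvd]
  push_cast
  omega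

theorem takeWhile_ne_append {α : Type*} [DecidableEq α] {u v : List α} {x : α} (h : x ∉ u) :
    (u ++ x :: v).takeWhile (· ≠ x) = u := by
  rw [List.takeWhile_append_of_pos]
  · simp
  · intro y hy
    simpa using fun hxy : y = x => h (hxy ▸ hy)

/-- In a checkerboard colorable diagram, the endpoints of an arrow have positions of opposite
parities. -/
theorem odd_idxOf_add_idxOf (hD : D.IsCheckerboardColorable) {a : ℕ} (ha : a ∈ D.arrows) :
    Odd (D.word.idxOf (a, true) + D.word.idxOf (a, false)) := by
  have hlen : Even (D.interval a).length := by
    have := (D.index_modEq_length a).symm.trans (hD a ha)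
    rw [Int.modEq_zero_iff_dvd] at this
    exact even_iff_two_dvd.2 (by exact_mod_cast this)
  have hw := D.even_length_word
  have hnd := D.nodup
  have ht := tail_mem_word ha
  have hh := D.closed _ _ ht
  simp only [Bool.not_true] at hh
  unfold interval at hlen
  generalize D.word = w at *
  obtain ⟨u, v, rfl⟩ := List.append_of_mem ht
  have hu : (a, true) ∉ u := by grind
  have h₁ : (u ++ (a, true) :: v).idxOf (a, true) = u.length := by
    simp [List.idxOf_append, hu]
  rw [h₁, List.rotate_append_length_eq] at hlen
  rw [h₁]
  simp only [List.cons_append, List.tail_cons] at hlen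
  have hh' : (a, false) ∈ u ∨ (a, false) ∈ v := by simpa using hh
  rcases hh' with h | h
  -- If the head comes first, the interval runs across the base point, and the even length of the
  -- word relates its parity to that of the complementary interval.
  · obtain ⟨u₁, u₂, rfl⟩ := List.append_of_mem h
    have h₂ : (a, false) ∉ v ++ u₁ := by grind
    have h₃ : (a, false) ∉ u₁ := by grind
    rw [← List.append_assoc, takeWhile_ne_append h₂] at hlen
    have h₄ : (u₁ ++ (a, false) :: u₂ ++ (a, true) :: v).idxOf (a, false) = u₁.length := by
      rw [List.append_assoc]
      simp [List.idxOf_append, h₃]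
    rw [h₄]
    simp only [List.length_append, List.length_cons] at hlen hw ⊢
    grind
  · obtain ⟨v₁, v₂, rfl⟩ := List.append_of_mem h
    have h₂ : (a, false) ∉ v₁ := by grind
    have h₃ : (a, false) ∉ u := by grind
    rw [List.append_assoc, List.cons_append, takeWhile_ne_append h₂] at hlen
    have h₄ : (u ++ (a, true) :: (v₁ ++ (a, false) :: v₂)).idxOf (a, false) =
        u.length + (v₁.length + 1) := by
      simp [List.idxOf_append, h₃, h₂]
      omega
    rw [h₄]
    grind

/-- The alternating orientation of the edges of the skeleton, evaluated at half-edges: it tells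
whether the orientation arrives at the marked point by the half-edge. -/
def alternating (D : FlatGaussDiagram) : D.HalfEdge → ZMod 2
  | (none, b) => if b then 1 else 0
  | (some p, _) => D.word.idxOf p.1

/-- The alternation closes up at the base point because the number of endpoints is even. -/
theorem alternating_succ (x : D.Pt) :
    D.alternating (x, true) + 1 = D.alternating (D.succ x, false) := by
  have h2 : (1 : ZMod 2) + 1 = 0 := rfl
  have hidx : ∀ (i : ℕ) (hi : i < D.word.length), D.word.idxOf D.word[i] = i :=
    fun i hi => D.nodup.idxOf_getElem i hi
  refine (forall_formPerm_iff D.nodup_pts D.mem_pts (fun x => D.alternating (x, false))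
    (fun x => D.alternating (x, true) + 1)).2 ⟨?_, ?_⟩ x
  · rw [List.isChain_iff_getElem]
    intro i hi
    have hi' : i < D.word.length := by simpa using hi
    rcases i with _ | i
    · simp [alternating, hidx, h2]
    · simp [alternating, hidx]
  · rw [List.getLast_eq_getElem]
    obtain ⟨m, hm⟩ := D.even_length_word
    rcases hn : D.word.length with _ | n
    · have : D.word = [] := List.eq_nil_of_length_eq_zero hn
      simp [alternating, this, h2]
    · have : n < D.word.length := by omega
      simp only [List.length_cons, List.length_map, List.length_attach, hn, Nat.add_sub_cancel,
        List.getElem_cons_succ, List.getElem_map, List.getElem_attach, alternating, hidx]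
      have : ((n + 1 : ℕ) : ZMod 2) = 0 := (ZMod.natCast_eq_zero_iff_even).2 ⟨m, by omega⟩
      simpa using this

theorem alternating_edgeFlip (h : D.HalfEdge) :
    D.alternating (D.edgeFlip h) = D.alternating h + 1 := by
  obtain ⟨x, _ | _⟩ := h
  · have := alternating_succ (D.succ.symm x)
    rw [Equiv.apply_symm_apply] at this
    rw [← this, add_assoc, show (1 : ZMod 2) + 1 = 0 from rfl, add_zero]
    rfl
  · exact (alternating_succ x).symm

/-- At an arrow endpoint the value depends only on the parity of its position, which differs at the
partner. Hence either smoothing is compatible with the alternating orientation. -/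
theorem alternating_smooth (hD : D.IsCheckerboardColorable) (h : D.HalfEdge) :
    D.alternating (D.smooth T h) = D.alternating h + 1 := by
  have h2 : (1 : ZMod 2) + 1 = 0 := rfl
  obtain ⟨_ | ⟨⟨a, s⟩, hp⟩, b⟩ := h
  · cases b <;> simp [alternating, smooth, h2]
  · have := odd_idxOf_add_idxOf hD (mem_arrows_of_mem hp)
    rw [← ZMod.natCast_eq_one_iff_odd, Nat.cast_add] at this
    simp only [alternating, smooth, partner]
    revert this
    cases s <;> simp only [Bool.not_true, Bool.not_false] <;>
      generalize (D.word.idxOf (a, true) : ZMod 2) = i <;>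
      generalize (D.word.idxOf (a, false) : ZMod 2) = j <;> revert i j <;> decide

/-- The single loop has two traversals, one along the alternating orientation and one against it. -/
theorem sameCycle_iff_alternating [Subsingleton (D.Loop T)] (hD : D.IsCheckerboardColorable)
    (h h' : D.HalfEdge) :
    (D.step T).SameCycle h h' ↔ D.alternating h = D.alternating h' := by
  have hstep : ∀ h, D.alternating (D.step T h) = D.alternating h := fun h => by
    rw [step_apply, alternating_edgeFlip, alternating_smooth hD, add_assoc,
      show (1 : ZMod 2) + 1 = 0 from rfl, add_zero]
  have hcyc : ∀ h', (D.step T).SameCycle h h' → D.alternating h = D.alternating h' := by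
    intro h' hh
    obtain ⟨n, -, -, rfl⟩ := hh.exists_pow_eq
    clear hh
    induction n with
    | zero => rfl
    | succ n ih => rw [pow_succ', Equiv.Perm.mul_apply, hstep, ih]
  refine ⟨hcyc h', fun ho => ?_⟩
  -- The union of a cycle and its reversal is invariant along loops, so it contains every half-edge.
  have key := eq_of_subsingleton_loop (T := T)
    (fun k => (D.step T).SameCycle h k ∨ (D.step T).SameCycle h (D.smooth T k)) (fun k => ?_)
    (fun k => ?_) h h'
  · have : (D.step T).SameCycle h h' ∨ (D.step T).SameCycle h (D.smooth T h') := by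
      rw [← key]
      exact Or.inl (Equiv.Perm.SameCycle.refl _ _)
    refine this.resolve_right fun hs => ?_
    have := hcyc _ hs
    rw [alternating_smooth hD, ho] at this
    simp at this
  · have h₁ : (D.step T).SameCycle h (D.edgeFlip k) ↔ (D.step T).SameCycle h (D.smooth T k) := by
      rw [← D.step_smooth T, Equiv.Perm.sameCycle_apply_right]
    have h₂ : (D.step T).SameCycle h (D.smooth T (D.edgeFlip k)) ↔ (D.step T).SameCycle h k := by
      rw [← Equiv.Perm.sameCycle_apply_right, step_smooth, D.edgeFlip_involutive]
    rw [h₁, h₂, or_comm]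
  · rw [D.smooth_involutive T, or_comm]

/-- In a checkerboard colorable diagram the cusps of a state with one loop cancel. -/
theorem cuspSum_eq_zero_of_checkerboard [Subsingleton (D.Loop T)]
    (hD : D.IsCheckerboardColorable) (h : D.HalfEdge) : D.cuspSum T h = 0 := by
  classical
  unfold cuspSum
  simp only [sameCycle_iff_alternating hD]
  rw [Fintype.sum_prod_type]
  refine Finset.sum_eq_zero fun x _ => ?_
  -- Both half-edges at an arrow endpoint have the same alternating value, so a traversal contains
  -- both or neither, and their cusp signs are opposite.
  rw [Fintype.sum_bool]
  rcases x with _ | p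
  · simp [cuspSign]
  · simp only [alternating, cuspSign]
    cases p.1.2 <;> by_cases hp : p.1.1 ∈ T <;> simp [hp] <;> split_ifs <;> simp

open Classical in
theorem stateMatrix_word_zmod {N : ℕ} [NeZero N] (hN : Even N) :
    stateMatrix (ZMod 2) N D.word 0 0 = ∑ T ∈ D.arrows.powerset,
      if Fintype.card (D.Loop T) = 1 ∧ ∃ x : D.HalfEdge → ZMod N, D.IsPotential T x then 1
      else 0 := by
  rw [← stateMatrix_map_natCast, stateMatrix_word, Nat.cast_sum]
  exact Finset.sum_congr rfl fun T _ => natCast_card_isPotential hN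

theorem stateMatrix_eq_constantCoeff {N : ℕ} [NeZero N] (hN : Even N)
    (hN' : Fintype.card D.HalfEdge < N) :
    stateMatrix (ZMod 2) N D.word 0 0 =
      ((MvPolynomial.constantCoeff D.arrowPolynomial : ℤ) : ZMod 2) := by
  rw [stateMatrix_word_zmod hN, constantCoeff_arrowPolynomial]
  refine Finset.sum_congr rfl fun T _ => ?_
  by_cases h : Fintype.card (D.Loop T) = 1
  · have := subsingleton_loop_of_card h
    simp only [h, true_and, exists_isPotential_iff hN']
  · simp [h]

/-- Every one-loop state has a labelling for every `N`, so the sum may be compared with the case of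
two labels. -/
theorem stateMatrix_of_checkerboard (hD : D.IsCheckerboardColorable) {N : ℕ} [NeZero N]
    (hN : Even N) : stateMatrix (ZMod 2) N D.word 0 0 = 1 := by
  have h₂ : stateMatrix (ZMod 2) 2 D.word 0 0 = 1 := by
    rw [stateMatrix_two _ D.nodup D.closed, Matrix.one_apply_eq]
  rw [← h₂, stateMatrix_word_zmod hN, stateMatrix_word_zmod even_two]
  refine Finset.sum_congr rfl fun T _ => ?_
  by_cases h : Fintype.card (D.Loop T) = 1
  · have := subsingleton_loop_of_card h
    simp only [exists_isPotential_zmod (cuspSum_eq_zero_of_checkerboard hD)]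
  · simp [h]

end FlatGaussDiagram

/-! ### The invariant and the conclusion. -/

/-- The state sum modulo two as an invariant of flat knots. -/
def FlatKnot.stateSum {N : ℕ} [NeZero N] (hN : Even N) : FlatKnot → ZMod 2 :=
  Quot.lift (fun D => stateMatrix (ZMod 2) N D.word 0 0) fun D D' h =>
    stateMatrix_eq_of_flatMove hN D.nodup D'.nodup h

/-- If a flat knot is checkerboard colorable, then, for each of its diagrams, the constant term of
the flat arrow polynomial, normalized or not, is odd. -/
theorem mainTheorem5 (α : FlatKnot) (hα : α.IsCheckerboardColorable)
    (D : FlatGaussDiagram) (hD : D.toFlatKnot = α) :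
    MvPolynomial.constantCoeff D.arrowPolynomial ≡ 1 [ZMOD 2] ∧
      MvPolynomial.constantCoeff D.normalizedArrowPolynomial ≡ 1 [ZMOD 2] := by
  obtain ⟨D₀, hD₀, hc⟩ := hα
  -- Even for invariance, and larger than the number of half-edges of `D` to detect its cusp sums.
  -- No bound in terms of `D₀` is required.
  let N := 2 * (Fintype.card D.HalfEdge + 1)
  have hN : Even N := even_two_mul _
  have : NeZero N := ⟨by omega⟩
  have h₁ : stateMatrix (ZMod 2) N D.word 0 0 = stateMatrix (ZMod 2) N D₀.word 0 0 :=
    congrArg (FlatKnot.stateSum hN) (hD.trans hD₀.symm)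
  rw [FlatGaussDiagram.stateMatrix_of_checkerboard hc hN,
    FlatGaussDiagram.stateMatrix_eq_constantCoeff hN (by omega)] at h₁
  have h₂ : ∀ z : ℤ, (z : ZMod 2) = 1 → z ≡ 1 [ZMOD 2] := fun z hz =>
    (ZMod.intCast_eq_intCast_iff z 1 2).1 (by simpa using hz)
  refine ⟨h₂ _ h₁, h₂ _ ?_⟩
  simp only [FlatGaussDiagram.normalizedArrowPolynomial, map_mul, map_pow, map_neg, map_one,
    Int.cast_mul, Int.cast_pow, Int.cast_neg, Int.cast_one]
  rw [show (-1 : ZMod 2) = 1 from rfl, one_pow, one_mul]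
  exact h₁
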